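/- Let $I$ be a set. A \emph{polynomial endofunctor over $I$} is a diagram of sets $I \xleftarrow{s} E \xrightarrow{p} B \xrightarrow{t} I$ in which $p$ has finite fibres (all polynomial endofunctors here are finitary); it induces the endofunctor $P = t_!\,p_*\,s^*$ of $\mathsf{Set}/I$, that is, $P(X)_i = \sum_{b \in t^{-1}(i)} \prod_{e \in E(b)} X_{s(e)}$, where $E(b) = p^{-1}(b)$. A morphism over $I$ from $(E,B)$ to $(E',B')$ is a pair of maps $E \to E'$, $B \to B'$ that commute with the structure maps (the maps to $I$ being preserved) and make the middle square a pullback. These form a category $\mathsf{PolyEnd}(I)$, monoidal under composition of polynomial functors. The category $\mathsf{PolyMnd}(I)$ of \emph{polynomial monads over $I$} is the category of monoids in $\mathsf{PolyEnd}(I)$. A polynomial monad $N$ over a set $J$ induces a monad on $\mathsf{Set}/J$, and $\mathsf{Alg}(N)$ denotes the category of Eilenberg--Moore algebras of this monad. Let $M$ be a polynomial monad over $I$ with underlying polynomial endofunctor $I \xleftarrow{s} E \xrightarrow{p} B \xrightarrow{t} I$. An \emph{$M$-tree} (up to isomorphism) is either a single edge with a colour $i \in I$ (without nodes, and with one leaf),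 or a root node labelled by some $b \in B$ together with, for each $e \in E(b)$, an $M$-tree with root colour $s(e)$ grafted on $e$; let $\mathrm{tr}\,M$ be the set of $M$-trees. The unit and the multiplication of $M$ contract each $M$-tree $T$ to an operation $\mathsf{t}(T) \in B$, its target, and give a colour-preserving bijection (the readdressing) between the leaves of $T$ and $E(\mathsf{t}(T))$. The \emph{Baez--Dolan construction} $M^+$ of $M$ is the polynomial monad over $B$ whose underlying polynomial endofunctor is $$B \xleftarrow{\ \mathsf{s}\ } \mathrm{tr}^{\bullet} M \longrightarrow \mathrm{tr}\,M \xrightarrow{\ \mathsf{t}\ } B,$$ where $\mathrm{tr}^{\bullet} M$ is the set of $M$-trees with a marked node, $\mathsf{s}$ is the label of the marked node, and the middle map forgets the marking; its unit sends $b \in B$ to the corolla at $b$ (the tree with one node, labelled $b$), and its multiplication substitutes, for each node $n$ of an $M$-tree $T$, an $M$-tree $U_n$ whose target is the label of $n$, using the readdressing of $U_n$ to connect the leaves of $U_n$ with the inputs of $n$. Then for every set $I$ and every polynomial monad $M$ over $I$ there is an equivalence of categories $$\mathsf{Alg}(M^+) \simeq \mathsf{PolyMnd}(I)/M .$$ 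-/

import Mathlib

open CategoryTheory MonoidalCategory

universe u

/-- A (finitary) polynomial endofunctor over `I`, i.e. a diagram of sets `I ← E → B → I`
(with maps `s`, `p`, `t`) such that `p` has finite fibres, presented by its fibres:
`Op i = t⁻¹(i)` is the set of operations `b ∈ B` of output colour `i`, and for such a `b`,
`In b j` is the set of the inputs `e ∈ E(b) = p⁻¹(b)` whose colour `s(e)` is `j`. So `B` is
`Σ i, Op i`, and `E(b)` is `Σ j, In b j`, which is required to be finite. -/
structure PolyEnd (I : Type u) where
  Op : I → Type u
  In : ∀ {i : I}, Op i → I → Type u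
  finitary : ∀ {i : I} (b : Op i), Finite (Σ j, In b j)

namespace PolyEnd

/-- Morphisms of polynomial endofunctors over `I` (identity on colours): a map `B → B'` over `I`
together with a map `E → E'` that covers it, commutes with the maps to `I`, and makes the middle
square cartesian, i.e. restricts to bijections `E(b) → E'(f b)`. The map `E → E'` is recorded
through the inverses `onIn` of these bijections. -/
structure Hom {I : Type u} (P Q : PolyEnd I) where
  onOp : ∀ {i : I}, P.Op i → Q.Op i
  onIn : ∀ {i : I} (b : P.Op i) (j : I), Q.In (onOp b) j → P.In b j
  cartesian : ∀ {i : I} (b : P.Op i) (j : I), Function.Bijective (onIn b j)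

/-- The category `PolyEnd(I)` of polynomial endofunctors over `I` and morphisms over `I`. -/
instance {I : Type u} : Category (PolyEnd I) where
  Hom := Hom
  id P := ⟨fun b => b, fun _ _ e => e, fun _ _ => Function.bijective_id⟩
  comp F G := ⟨fun b => G.onOp (F.onOp b), fun b j e => F.onIn b j (G.onIn (F.onOp b) j e),
    fun b j => (F.cartesian b j).comp (G.cartesian (F.onOp b) j)⟩

/-- The value of the polynomial functor at a family `Z` of sets indexed by `I`, i.e. at an object
of `Set/I`: `P(Z)_i = ∑_{b ∈ B(i)} ∏_{e ∈ E(b)} Z_{s(e)}`. -/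
def eval {I : Type u} (P : PolyEnd I) (Z : I → Type u) (i : I) : Type u :=
  Σ b : P.Op i, ∀ j, P.In b j → Z j

/-- The polynomial functor on maps. -/
def evalMap {I : Type u} (P : PolyEnd I) {Z W : I → Type u} (f : ∀ j, Z j → W j) {i : I}
    (x : P.eval Z i) : P.eval W i :=
  ⟨x.1, fun j e => f j (x.2 j e)⟩

/-- The (cartesian) natural transformation induced by a morphism of polynomial functors. -/
def Hom.app {I : Type u} {P Q : PolyEnd I} (F : P ⟶ Q) {Z : I → Type u} {i : I}
    (x : P.eval Z i) : Q.eval Z i :=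
  ⟨F.onOp x.1, fun j e => x.2 j (F.onIn x.1 j e)⟩

theorem Hom.ext_app {I : Type u} {P Q : PolyEnd I} {F G : P ⟶ Q}
    (h : ∀ (i : I) (b : P.Op i),
      Hom.app F (⟨b, fun _ e => e⟩ : P.eval (P.In b) i) = Hom.app G ⟨b, fun _ e => e⟩) :
    F = G := by
  obtain ⟨f1, f2, hf⟩ := F
  obtain ⟨g1, g2, hg⟩ := G
  have h1 : @f1 = @g1 := by
    funext i b
    exact congrArg Sigma.fst (h i b)
  subst h1
  have h2 : @f2 = @g2 := by
    funext i b
    exact eq_of_heq (Sigma.mk.inj (h i b)).2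
  subst h2
  rfl

/-- The identity polynomial endofunctor `I ← I → I → I`. -/
def unit (I : Type u) : PolyEnd I where
  Op _ := PUnit
  In {i} _ j := ULift (PLift (i = j))
  finitary {i} _ := by
    have : Subsingleton (Σ j, ULift.{u} (PLift (i = j))) := by
      constructor
      rintro ⟨_, ⟨⟨rfl⟩⟩⟩ ⟨_, ⟨⟨rfl⟩⟩⟩
      rfl
    infer_instance

/-- Composition of polynomial endofunctors: an operation of `P ∘ Q` is an operation `b` of `P`
with an operation of `Q` of the matching output colour for each input of `b`; its inputs are
the inputs of the latter operations. -/
def comp {I : Type u} (P Q : PolyEnd I) : PolyEnd I where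
  Op i := P.eval Q.Op i
  In x k := Σ j, Σ e : P.In x.1 j, Q.In (x.2 j e) k
  finitary x := by
    have := P.finitary x.1
    have (y : Σ j, P.In x.1 j) := Q.finitary (x.2 y.1 y.2)
    refine Finite.of_surjective
      (α := Σ y : (Σ j, P.In x.1 j), Σ k, Q.In (x.2 y.1 y.2) k)
      (fun z => ⟨z.2.1, z.1.1, z.1.2, z.2.2⟩) ?_
    rintro ⟨k, j, e, e'⟩
    exact ⟨⟨⟨j, e⟩, k, e'⟩, rfl⟩

/-- Horizontal composition of morphisms. -/
def compMap {I : Type u} {P P' Q Q' : PolyEnd I} (F : P ⟶ P') (G : Q ⟶ Q') :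
    P.comp Q ⟶ P'.comp Q' where
  onOp x := ⟨F.onOp x.1, fun j e => G.onOp (x.2 j (F.onIn x.1 j e))⟩
  onIn x k y := ⟨y.1, F.onIn x.1 y.1 y.2.1, G.onIn _ k y.2.2⟩
  cartesian x k := by
    constructor
    · rintro ⟨j, e, a⟩ ⟨j', e', a'⟩ h
      obtain ⟨rfl, h⟩ := Sigma.mk.inj h
      obtain ⟨h1, h2⟩ := Sigma.mk.inj (eq_of_heq h)
      obtain rfl := (F.cartesian x.1 j).1 h1
      obtain rfl := (G.cartesian _ k).1 (eq_of_heq h2)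
      rfl
    · rintro ⟨j, e, a⟩
      obtain ⟨e, rfl⟩ := (F.cartesian x.1 j).2 e
      obtain ⟨a, rfl⟩ := (G.cartesian _ k).2 a
      exact ⟨⟨j, e, a⟩, rfl⟩


/-- Helper for building isomorphisms. -/
def isoMk {I : Type u} {P Q : PolyEnd I} (F : P ⟶ Q) (G : Q ⟶ P)
    (hF : ∀ i, Function.Injective (Hom.onOp F (i := i))) (h : G ≫ F = 𝟙 Q) : P ≅ Q where
  hom := F
  inv := G
  hom_inv_id := by
    have inj : ∀ (Z : I → Type u) (i : I) (x y : P.eval Z i),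
        Hom.app F x = Hom.app F y → x = y := by
      rintro Z i ⟨b, x⟩ ⟨c, y⟩ hxy
      obtain ⟨h1, h2⟩ := Sigma.mk.inj hxy
      obtain rfl : b = c := hF i h1
      congr 1
      funext j e
      obtain ⟨e, rfl⟩ := (F.cartesian b j).2 e
      exact congrFun (congrFun (eq_of_heq h2) j) e
    refine Hom.ext_app fun i b => inj _ _ _ _ ?_
    change Hom.app (G ≫ F) (Hom.app F _) = _
    rw [h]
    rfl
  inv_hom_id := h

/-- The associativity constraint of composition. -/
def assocHom {I : Type u} (P Q R : PolyEnd I) : (P.comp Q).comp R ⟶ P.comp (Q.comp R) where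
  onOp x := ⟨x.1.1, fun j e => ⟨x.1.2 j e, fun k e' => x.2 k ⟨j, e, e'⟩⟩⟩
  onIn _ _ y := ⟨y.2.2.1, ⟨y.1, y.2.1, y.2.2.2.1⟩, y.2.2.2.2⟩
  cartesian _ _ := Function.bijective_iff_has_inverse.2
    ⟨fun y => ⟨y.2.1.1, y.2.1.2.1, y.1, y.2.1.2.2, y.2.2⟩, fun _ => rfl, fun _ => rfl⟩

/-- The inverse of the associativity constraint. -/
def assocInv {I : Type u} (P Q R : PolyEnd I) : P.comp (Q.comp R) ⟶ (P.comp Q).comp R where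
  onOp x := ⟨⟨x.1, fun j e => (x.2 j e).1⟩, fun k y => (x.2 y.1 y.2.1).2 k y.2.2⟩
  onIn _ _ y := ⟨y.2.1.1, y.2.1.2.1, y.1, y.2.1.2.2, y.2.2⟩
  cartesian _ _ := Function.bijective_iff_has_inverse.2
    ⟨fun y => ⟨y.2.2.1, ⟨y.1, y.2.1, y.2.2.2.1⟩, y.2.2.2.2⟩, fun _ => rfl, fun _ => rfl⟩

/-- The associativity isomorphism. -/
def assocIso {I : Type u} (P Q R : PolyEnd I) : (P.comp Q).comp R ≅ P.comp (Q.comp R) where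
  hom := assocHom P Q R
  inv := assocInv P Q R
  hom_inv_id := rfl
  inv_hom_id := rfl

/-- The left unit isomorphism. -/
def leftIso {I : Type u} (P : PolyEnd I) : (unit I).comp P ≅ P :=
  isoMk
    { onOp := fun {i} x => x.2 i ⟨⟨rfl⟩⟩
      onIn := fun {i} x k e => ⟨i, ⟨⟨rfl⟩⟩, e⟩
      cartesian := fun {i} x k => by
        constructor
        · rintro e e' h
          exact eq_of_heq (Sigma.mk.inj (eq_of_heq (Sigma.mk.inj h).2)).2
        · rintro ⟨_, ⟨⟨rfl⟩⟩, e⟩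
          exact ⟨e, rfl⟩ }
    { onOp := fun {i} b => ⟨⟨⟩, fun j h => h.down.down ▸ b⟩
      onIn := fun {i} b k y => match y with | ⟨_, ⟨⟨rfl⟩⟩, e⟩ => e
      cartesian := fun {i} b k => by
        constructor
        · rintro ⟨_, ⟨⟨rfl⟩⟩, e⟩ ⟨_, ⟨⟨rfl⟩⟩, e'⟩ h
          obtain rfl : e = e' := h
          rfl
        · intro e
          exact ⟨⟨i, ⟨⟨rfl⟩⟩, e⟩, rfl⟩ }
    (by
      rintro i ⟨⟨⟩, b⟩ ⟨⟨⟩, c⟩ h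
      congr 1
      funext j ⟨⟨hj⟩⟩
      subst hj
      exact h)
    rfl

/-- The right unit isomorphism. -/
def rightIso {I : Type u} (P : PolyEnd I) : P.comp (unit I) ≅ P :=
  isoMk
    { onOp := fun x => x.1
      onIn := fun x k e => ⟨k, e, ⟨⟨rfl⟩⟩⟩
      cartesian := fun {i} x k => by
        constructor
        · rintro e e' h
          exact (Sigma.mk.inj (eq_of_heq (Sigma.mk.inj h).2)).1
        · rintro ⟨_, e, ⟨⟨rfl⟩⟩⟩
          exact ⟨e, rfl⟩ }
    { onOp := fun {i} b => ⟨b, fun _ _ => ⟨⟩⟩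
      onIn := fun {i} b k y => match y with | ⟨_, e, ⟨⟨rfl⟩⟩⟩ => e
      cartesian := fun {i} b k => by
        constructor
        · rintro ⟨_, e, ⟨⟨rfl⟩⟩⟩ ⟨_, e', ⟨⟨rfl⟩⟩⟩ h
          obtain rfl : e = e' := h
          rfl
        · intro e
          exact ⟨⟨_, e, ⟨⟨rfl⟩⟩⟩, rfl⟩ }
    (by
      rintro i ⟨b, x⟩ ⟨c, y⟩ h
      obtain rfl : b = c := h
      congr 1
      funext _ _
      rfl)
    rfl

instance {I : Type u} : MonoidalCategoryStruct (PolyEnd I) where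
  tensorObj := comp
  whiskerLeft P _ _ G := compMap (𝟙 P) G
  whiskerRight F Q := compMap F (𝟙 Q)
  tensorHom := compMap
  tensorUnit := unit I
  associator := assocIso
  leftUnitor := leftIso
  rightUnitor := rightIso

/-- `PolyEnd(I)` is monoidal under composition of polynomial functors. -/
instance {I : Type u} : MonoidalCategory (PolyEnd I) where
  tensorHom_def _ _ := rfl
  id_tensorHom_id _ _ := rfl
  tensorHom_comp_tensorHom _ _ _ _ := rfl
  whiskerLeft_id _ _ := rfl
  id_whiskerRight _ _ := rfl
  associator_naturality _ _ _ := rfl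
  leftUnitor_naturality _ := rfl
  rightUnitor_naturality _ := rfl
  pentagon _ _ _ _ := rfl
  triangle _ _ := rfl


/-- The isomorphism `P(Q(Z)) ≅ (P ∘ Q)(Z)`. -/
def flatten {I : Type u} {P Q : PolyEnd I} {Z : I → Type u} {i : I} (x : P.eval (Q.eval Z) i) :
    (P.comp Q).eval Z i :=
  ⟨⟨x.1, fun j e => (x.2 j e).1⟩, fun k y => (x.2 y.1 y.2.1).2 k y.2.2⟩

/-- The isomorphism of `Z` with the value of the identity polynomial at `Z`. -/
def ofUnit {I : Type u} {Z : I → Type u} {i : I} (z : Z i) : (unit I).eval Z i :=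
  ⟨⟨⟩, fun _ h => h.down.down ▸ z⟩

end PolyEnd

/-- The category `PolyMnd(I)` of polynomial monads over `I`: monoids in `PolyEnd(I)`, and
morphisms of monoids. -/
abbrev PolyMnd (I : Type u) := Mon (PolyEnd I)

namespace PolyMnd

open PolyEnd

variable {I : Type u} (M : PolyMnd I)

/-- The unit of the monad on families of sets given by a polynomial monad. -/
def pure {Z : I → Type u} {i : I} (z : Z i) : M.X.eval Z i :=
  Hom.app (MonObj.one : 𝟙_ (PolyEnd I) ⟶ M.X) (ofUnit z)

/-- The multiplication of the monad on families of sets given by a polynomial monad. -/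
def join {Z : I → Type u} {i : I} (x : M.X.eval (M.X.eval Z) i) : M.X.eval Z i :=
  Hom.app (MonObj.mul : M.X ⊗ M.X ⟶ M.X) (flatten x)

theorem join_pure {Z : I → Type u} {i : I} (x : M.X.eval Z i) : M.join (M.pure x) = x :=
  congrArg (fun F => Hom.app F (flatten (ofUnit x) : ((unit I).comp M.X).eval Z i))
    (MonObj.one_mul M.X)

theorem join_map_pure {Z : I → Type u} {i : I} (x : M.X.eval Z i) :
    M.join (M.X.evalMap (fun _ => M.pure) x) = x :=
  congrArg (fun F => Hom.app F
    (flatten (M.X.evalMap (fun _ => ofUnit) x) : (M.X.comp (unit I)).eval Z i))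
    (MonObj.mul_one M.X)

theorem join_join {Z : I → Type u} {i : I} (x : M.X.eval (M.X.eval (M.X.eval Z)) i) :
    M.join (M.join x) = M.join (M.X.evalMap (fun _ => M.join) x) :=
  congrArg (fun F => Hom.app F
    (flatten (flatten x) : ((M.X.comp M.X).comp M.X).eval Z i))
    (MonObj.mul_assoc M.X)

/-- The monad on `Set/I` (families of sets indexed by `I`) given by a polynomial monad `M` over
`I`. The category `Alg(M)` is the category of (Eilenberg--Moore) algebras of this monad. -/
def toMonad : CategoryTheory.Monad (I → Type u) where
  obj Z i := M.X.eval Z i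
  map f i := ↾(fun x => M.X.evalMap (fun j => f j) x)
  η :=
    { app := fun Z i => ↾(fun z => M.pure z)
      naturality := by
        intro Z W f
        funext i
        ext z
        refine congrArg (Sigma.mk _) ?_
        funext j e
        generalize Hom.onIn _ _ _ _ = h
        obtain ⟨⟨rfl⟩⟩ := h
        rfl }
  μ := { app := fun Z i => ↾(fun x => M.join x) }
  assoc Z := by
    funext i
    ext x
    exact (M.join_join x).symm
  left_unit Z := by
    funext i
    ext x
    exact M.join_pure x
  right_unit Z := by
    funext i
    ext x
    exact M.join_map_pure x


theorem map_pure {Z W : I → Type u} (f : ∀ j, Z j → W j) {i : I} (z : Z i) :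
    M.X.evalMap f (M.pure z) = M.pure (f i z) := by
  have key : ∀ j (h : ULift.{u} (PLift (i = j))),
      f j (h.down.down ▸ z) = (h.down.down ▸ f i z : W j) := by
    rintro j ⟨⟨rfl⟩⟩
    rfl
  exact congrArg (Sigma.mk _) (funext fun j => funext fun e =>
    key j (Hom.onIn (MonObj.one : 𝟙_ (PolyEnd I) ⟶ M.X) (⟨⟩ : (unit I).Op i) j e))

end PolyMnd

/-- The bijections on inputs given by a morphism. -/
noncomputable def PolyEnd.inEquiv {I : Type u} {P Q : PolyEnd I} (F : P ⟶ Q) {i : I} (b : P.Op i) (j : I) :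
    Q.In (Hom.onOp F b) j ≃ P.In b j :=
  Equiv.ofBijective (Hom.onIn F b j) (Hom.cartesian F b j)

/-- `P`-trees with root edge of the given colour, whose nodes carry decorations from `X` and whose
leaves carry decorations from `Z`: such a tree is either a single edge of colour `i` (no node, one
leaf), or it is an operation `b` of `P` (the root node, with a decoration in `X_b`) with a tree
grafted on each of its inputs, the root colour of which is the colour of the input.
The trees are finite since `P` is finitary. A `P`-tree is a tree with trivial decorations:
`DTree P (fun _ => PUnit) (fun _ => PUnit) i` is the set of (isomorphism classes of) `P`-trees
whose root edge has colour `i`. -/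
inductive DTree {I : Type u} (P : PolyEnd I) (X : (Σ i, P.Op i) → Type u) (Z : I → Type u) :
    I → Type u
  | leaf {i : I} (z : Z i) : DTree P X Z i
  | node {i : I} (b : P.Op i) (x : X ⟨i, b⟩) (c : ∀ j, P.In b j → DTree P X Z j) : DTree P X Z i

namespace DTree

open PolyEnd

variable {I : Type u} {P : PolyEnd I}

/-- Change of the decorations of the nodes. -/
def mapNode {X Y : (Σ i, P.Op i) → Type u} {Z : I → Type u} (f : ∀ a, X a → Y a) :
    ∀ {i : I}, DTree P X Z i → DTree P Y Z i
  | _, leaf z => leaf z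
  | _, node b x c => node b (f _ x) fun j e => mapNode f (c j e)

/-- Grafting of trees on all leaves, the tree grafted on a leaf depending on its decoration. -/
def bind {X : (Σ i, P.Op i) → Type u} {Z W : I → Type u} :
    ∀ {i : I}, DTree P X Z i → (∀ j, Z j → DTree P X W j) → DTree P X W i
  | i, leaf z, k => k i z
  | _, node b x c, k => node b x fun j e => bind (c j e) k

/-- `Node T a` is the set of the nodes of `T` that are labelled by the operation `a` of `P`. -/
def Node {X : (Σ i, P.Op i) → Type u} {Z : I → Type u} :
    ∀ {i : I}, DTree P X Z i → (Σ i, P.Op i) → Type u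
  | _, leaf _, _ => PEmpty
  | i, node b _ c, a => ULift (PLift (⟨i, b⟩ = a)) ⊕ (Σ j, Σ e : P.In b j, Node (c j e) a)

/-- Forget the decorations of the nodes. -/
def erase {X : (Σ i, P.Op i) → Type u} {Z : I → Type u} {i : I} (V : DTree P X Z i) :
    DTree P (fun _ => PUnit) Z i :=
  mapNode (fun _ _ => ⟨⟩) V

/-- The decoration of a node. -/
def label {X : (Σ i, P.Op i) → Type u} {Z : I → Type u} :
    ∀ {i : I} (V : DTree P X Z i) (a : Σ i, P.Op i), Node (erase V) a → X a
  | _, leaf _, _, n => nomatch n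
  | i, node b x c, a, n =>
    match (n : ULift (PLift (⟨i, b⟩ = a)) ⊕ (Σ j, Σ e : P.In b j, Node (erase (c j e)) a)) with
    | Sum.inl h => h.down.down ▸ x
    | Sum.inr n => label (c n.1 n.2.1) a n.2.2

/-- Decorate the nodes of a tree. -/
def decorate {X Y : (Σ i, P.Op i) → Type u} {Z : I → Type u} :
    ∀ {i : I} (T : DTree P X Z i), (∀ a, Node T a → Y a) → DTree P Y Z i
  | _, leaf z, _ => leaf z
  | i, node b _ c, y => node b (y ⟨i, b⟩ (Sum.inl ⟨⟨rfl⟩⟩))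
      fun j e => decorate (c j e) fun a n => y a (Sum.inr ⟨j, e, n⟩)

variable {X Y : (Σ i, P.Op i) → Type u} {Z W : I → Type u} {i : I}

theorem finite_node (T : DTree P X Z i) : Finite (Σ a, Node T a) := by
  induction T with
  | leaf z => exact Finite.of_injective (β := PEmpty.{1}) (fun x => nomatch x.2) fun x => nomatch x.2
  | @node i b x c ih =>
    have := P.finitary b
    have (y : Σ j, P.In b j) := ih y.1 y.2
    refine Finite.of_surjective
      (α := Option (Σ y : (Σ j, P.In b j), Σ a, Node (c y.1 y.2) a))
      (fun o => match o with
        | none => ⟨⟨i, b⟩, Sum.inl ⟨⟨rfl⟩⟩⟩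
        | some n => ⟨n.2.1, Sum.inr ⟨n.1.1, n.1.2, n.2.2⟩⟩) ?_
    rintro ⟨a, ⟨⟨⟨rfl⟩⟩⟩ | ⟨j, e, n⟩⟩
    · exact ⟨none, rfl⟩
    · exact ⟨some ⟨⟨j, e⟩, a, n⟩, rfl⟩

theorem mapNode_mapNode {X' : (Σ i, P.Op i) → Type u} (f : ∀ a, X a → Y a) (g : ∀ a, Y a → X' a)
    (V : DTree P X Z i) : mapNode g (mapNode f V) = mapNode (fun a x => g a (f a x)) V := by
  induction V with
  | leaf z => rfl
  | node b x c ih => simp only [mapNode, ih]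

theorem mapNode_bind (f : ∀ a, X a → Y a) (V : DTree P X Z i) (k : ∀ j, Z j → DTree P X W j) :
    mapNode f (bind V k) = bind (mapNode f V) (fun j z => mapNode f (k j z)) := by
  induction V with
  | leaf z => rfl
  | node b x c ih => simp only [mapNode, bind, ih]

theorem bind_bind {W' : I → Type u} (V : DTree P X Z i) (k : ∀ j, Z j → DTree P X W j)
    (l : ∀ j, W j → DTree P X W' j) :
    bind (bind V k) l = bind V (fun j z => bind (k j z) l) := by
  induction V with
  | leaf z => rfl
  | node b x c ih => simp only [bind, ih]

theorem bind_unit (V : DTree P X (fun _ => PUnit) i) : bind V (fun _ _ => leaf ⟨⟩) = V := by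
  induction V with
  | leaf z => rfl
  | node b x c ih => simp only [bind, ih]

/-- Forget the decorations of the leaves. -/
def eraseLeaf (V : DTree P X Z i) : DTree P X (fun _ => PUnit) i := bind V fun _ _ => leaf ⟨⟩

theorem erase_decorate (T : DTree P (fun _ => PUnit) Z i) (y : ∀ a, Node T a → Y a) :
    erase (decorate T y) = T := by
  unfold erase
  induction T with
  | leaf z => rfl
  | node b x c ih => simp only [decorate, mapNode, ih]

theorem decorate_label (V : DTree P X Z i) : decorate (erase V) (label V) = V := by
  induction V with
  | leaf z => rfl
  | node b x c ih =>
    change node b x (fun j e => decorate (erase (c j e)) (label (c j e))) = _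
    simp only [ih]

theorem mapNode_decorate {X' : (Σ i, P.Op i) → Type u} (T : DTree P X Z i)
    (y : ∀ a, Node T a → Y a) (f : ∀ a, Y a → X' a) :
    mapNode f (decorate T y) = decorate T (fun a n => f a (y a n)) := by
  induction T with
  | leaf z => rfl
  | node b x c ih => simp only [decorate, mapNode, ih]

theorem decorate_inj (T : DTree P X Z i) (y y' : ∀ a, Node T a → Y a)
    (h : decorate T y = decorate T y') : y = y' := by
  induction T with
  | leaf z => funext a n; nomatch n
  | node b x c ih =>
    simp only [decorate, node.injEq, true_and, heq_eq_eq] at h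
    funext a n
    obtain ⟨⟨⟨rfl⟩⟩⟩ | ⟨j, e, n⟩ := n
    · exact h.1
    · exact congrFun (congrFun (ih j e _ _ (congrFun (congrFun h.2 j) e)) a) n

end DTree

namespace PolyMnd

open PolyEnd DTree

variable {I : Type u} (M : PolyMnd I)

/-- Contraction of `M`-trees by the monad structure of `M`: a tree contracts to an operation of
`M` (its target), whose inputs correspond to the leaves of the tree; the inputs of the target are
returned with the decorations of these leaves. -/
def contract {X : (Σ i, M.X.Op i) → Type u} {Z : I → Type u} :
    ∀ {i : I}, DTree M.X X Z i → M.X.eval Z i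
  | _, leaf z => M.pure z
  | _, node b _ c => M.join ⟨b, fun j e => contract (c j e)⟩

/-- The target of an `M`-tree, the operation of `M` to which the tree contracts. -/
def target {X : (Σ i, M.X.Op i) → Type u} {Z : I → Type u} {i : I} (T : DTree M.X X Z i) :
    M.X.Op i :=
  (M.contract T).1

/-- Readdressing: the leaves of `T` correspond to the inputs of its target; replace the decoration
of each leaf by the given decoration of the corresponding input of the target. -/
noncomputable def readdress {X : (Σ i, M.X.Op i) → Type u} {Z W : I → Type u} :
    ∀ {i : I} (T : DTree M.X X Z i), (∀ j, M.X.In (M.target T) j → W j) → DTree M.X X W i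
  | i, leaf _, g =>
      leaf (g i ((inEquiv (MonObj.one : 𝟙_ (PolyEnd I) ⟶ M.X) ⟨⟩ i).symm ⟨⟨rfl⟩⟩))
  | _, node b x c, g => node b x fun j e => readdress (c j e) fun k e' =>
      g k ((inEquiv (MonObj.mul : M.X ⊗ M.X ⟶ M.X)
        (⟨b, fun j e => M.target (c j e)⟩ : M.X.eval M.X.Op _) k).symm ⟨j, e, e'⟩)

/-- `M`-trees with target `a` whose nodes are decorated by `X`. -/
abbrev Deco (X : (Σ i, M.X.Op i) → Type u) (a : Σ i, M.X.Op i) : Type u :=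
  {U : DTree M.X X (fun _ => PUnit) a.1 // M.target U = a.2}

/-- Substitution: given an `M`-tree each node of which, labelled `b` say, is decorated by an
`M`-tree `U` with target `b`, replace all these nodes by the trees `U`. What was grafted on an input
of `b` is now grafted on the leaf of `U` that the readdressing of `U` matches with that input. -/
noncomputable def subst {X : (Σ i, M.X.Op i) → Type u} {Z : I → Type u} :
    ∀ {i : I}, DTree M.X (M.Deco X) Z i → DTree M.X X Z i
  | _, leaf z => leaf z
  | _, node b U c => DTree.bind (M.readdress U.1 (W := M.X.In b) fun j e =>
        cast (congrArg (fun b => M.X.In b j) U.2) e)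
      fun j e => subst (c j e)

/-- The polynomial endofunctor underlying `M⁺`, over the set `B = Σ i, M.X.Op i` of operations of
`M`: its operations are the `M`-trees, the output colour of a tree is its target, and the inputs of
a tree are its nodes, each coloured by its label. -/
def plus : PolyEnd (Σ i, M.X.Op i) where
  Op a := {T : DTree M.X (fun _ => PUnit) (fun _ => PUnit) a.1 // M.target T = a.2}
  In T a := T.1.Node a
  finitary T := finite_node T.1


section contraction

variable {X Y : (Σ i, M.X.Op i) → Type u} {Z W : I → Type u} {i : I}

theorem pure_eq (g : ∀ j, M.X.In (Hom.onOp (MonObj.one : 𝟙_ (PolyEnd I) ⟶ M.X) (i := i) ⟨⟩) j → Z j) :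
    M.pure (g i ((inEquiv (MonObj.one : 𝟙_ (PolyEnd I) ⟶ M.X) ⟨⟩ i).symm ⟨⟨rfl⟩⟩)) = ⟨_, g⟩ := by
  have key : ∀ j (h : ULift.{u} (PLift (i = j))),
      (h.down.down ▸ g i ((inEquiv (MonObj.one : 𝟙_ (PolyEnd I) ⟶ M.X) ⟨⟩ i).symm ⟨⟨rfl⟩⟩) : Z j)
        = g j ((inEquiv (MonObj.one : 𝟙_ (PolyEnd I) ⟶ M.X) ⟨⟩ j).symm h) := by
    rintro j ⟨⟨rfl⟩⟩
    rfl
  refine congrArg (Sigma.mk _) (funext fun j => funext fun e =>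
    (key j (Hom.onIn (MonObj.one : 𝟙_ (PolyEnd I) ⟶ M.X) (⟨⟩ : (unit I).Op i) j e)).trans ?_)
  exact congrArg (g j) ((inEquiv (MonObj.one : 𝟙_ (PolyEnd I) ⟶ M.X) ⟨⟩ j).symm_apply_apply e)

theorem join_inj {b : M.X.Op i} {w w' : ∀ j, M.X.In b j → M.X.eval Z j}
    (h : ∀ j e, (w j e).1 = (w' j e).1) (h' : M.join ⟨b, w⟩ = M.join ⟨b, w'⟩) : w = w' := by
  obtain ⟨u, z, rfl⟩ : ∃ (u : ∀ j, M.X.In b j → M.X.Op j) (z : ∀ j e k, M.X.In (u j e) k → Z k),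
      w = fun j e => ⟨u j e, z j e⟩ := ⟨fun j e => (w j e).1, fun j e => (w j e).2, rfl⟩
  obtain ⟨u', z', rfl⟩ : ∃ (u : ∀ j, M.X.In b j → M.X.Op j) (z : ∀ j e k, M.X.In (u j e) k → Z k),
      w' = fun j e => ⟨u j e, z j e⟩ := ⟨fun j e => (w' j e).1, fun j e => (w' j e).2, rfl⟩
  obtain rfl : u = u' := funext fun j => funext fun e => h j e
  have h2 := eq_of_heq (Sigma.mk.inj h').2
  funext j e
  refine congrArg (Sigma.mk _) (funext fun k => funext fun e' => ?_)
  obtain ⟨e'', he⟩ := (Hom.cartesian (MonObj.mul : M.X ⊗ M.X ⟶ M.X)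
    (⟨b, u⟩ : M.X.eval M.X.Op i) k).2 ⟨j, e, e'⟩
  have h3 := congrFun (congrFun h2 k) e''
  have key : ∀ y : (M.X.comp M.X).In (⟨b, u⟩ : M.X.eval M.X.Op i) k, y = ⟨j, e, e'⟩ →
      z y.1 y.2.1 k y.2.2 = z' y.1 y.2.1 k y.2.2 → z j e k e' = z' j e k e' := by
    rintro _ rfl h
    exact h
  exact key _ he h3

theorem contract_mapNode (f : ∀ a, X a → Y a) (V : DTree M.X X Z i) :
    M.contract (mapNode f V) = M.contract V := by
  induction V with
  | leaf z => rfl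
  | node b x c ih => simp only [mapNode, contract, ih]

theorem contract_decorate (T : DTree M.X X Z i) (y : ∀ a, Node T a → Y a) :
    M.contract (decorate T y) = M.contract T := by
  induction T with
  | leaf z => rfl
  | node b x c ih => simp only [decorate, contract, ih]

theorem contract_bind (V : DTree M.X X Z i) (k : ∀ j, Z j → DTree M.X X W j) :
    M.contract (DTree.bind V k)
      = M.join (M.X.evalMap (fun j z => M.contract (k j z)) (M.contract V)) := by
  induction V with
  | leaf z => simp only [DTree.bind, contract, map_pure, join_pure]
  | node b x c ih =>
    simp only [DTree.bind, contract, ih]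
    exact (M.join_join ⟨b, fun j e =>
      M.X.evalMap (fun j z => M.contract (k j z)) (M.contract (c j e))⟩).symm

theorem contract_readdress (T : DTree M.X X Z i) (g : ∀ j, M.X.In (M.target T) j → W j) :
    M.contract (M.readdress T g) = ⟨M.target T, g⟩ := by
  induction T with
  | leaf z => exact M.pure_eq g
  | node b x c ih =>
    simp only [readdress, contract, ih]
    refine congrArg (Sigma.mk _) (funext fun k => funext fun e => congrArg (g k) ?_)
    exact (inEquiv (MonObj.mul : M.X ⊗ M.X ⟶ M.X) _ k).symm_apply_apply e

theorem eraseLeaf_readdress (T : DTree M.X X Z i) (g : ∀ j, M.X.In (M.target T) j → W j) :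
    eraseLeaf (M.readdress T g) = eraseLeaf T := by
  unfold eraseLeaf
  induction T with
  | leaf z => rfl
  | node b x c ih => simp only [readdress, DTree.bind, ih]

theorem contract_eraseLeaf (V : DTree M.X X Z i) :
    M.contract (eraseLeaf V) = M.X.evalMap (fun _ _ => ⟨⟩) (M.contract V) := by
  rw [eraseLeaf, contract_bind]
  exact M.join_map_pure (M.X.evalMap (fun _ _ => PUnit.unit) (M.contract V))

theorem tree_ext (V V' : DTree M.X X Z i) (h : eraseLeaf V = eraseLeaf V')
    (h' : M.contract V = M.contract V') : V = V' := by
  induction V with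
  | @leaf i z =>
    cases V' with
    | leaf z' =>
      obtain ⟨-, h2⟩ := Sigma.mk.inj h'
      have h3 := congrFun (congrFun (eq_of_heq h2) i)
        ((inEquiv (MonObj.one : 𝟙_ (PolyEnd I) ⟶ M.X) ⟨⟩ i).symm ⟨⟨rfl⟩⟩)
      exact congrArg leaf h3
    | node b x c => nomatch h
  | node b x c ih =>
    cases V' with
    | leaf z' => nomatch h
    | node b' x' c' =>
      simp only [eraseLeaf, DTree.bind, node.injEq] at h
      obtain ⟨rfl, h1, h2⟩ := h
      obtain rfl := eq_of_heq h1
      have h3 : ∀ j e, eraseLeaf (c j e) = eraseLeaf (c' j e) := fun j e =>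
        congrFun (congrFun (eq_of_heq h2) j) e
      have h4 := M.join_inj (fun j e => by
        have := congrArg Sigma.fst (congrArg M.contract (h3 j e))
        rwa [contract_eraseLeaf, contract_eraseLeaf] at this) h'
      congr 1
      funext j e
      exact ih j e _ (h3 j e) (congrFun (congrFun h4 j) e)

theorem subst_node {b : M.X.Op i} (U : M.Deco X ⟨i, b⟩)
    (c : ∀ j, M.X.In b j → DTree M.X (M.Deco X) Z j) (V : DTree M.X X (M.X.In b) i)
    (h : eraseLeaf V = U.1) (h' : M.contract V = ⟨b, fun _ e => e⟩) :
    M.subst (node b U c) = DTree.bind V fun j e => M.subst (c j e) := by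
  have key : ∀ (U : DTree M.X X (fun _ => PUnit) i) (b : M.X.Op i) (hU : M.target U = b)
      (c : ∀ j, M.X.In b j → DTree M.X (M.Deco X) Z j) (V : DTree M.X X (M.X.In b) i)
      (_ : eraseLeaf V = U) (_ : M.contract V = ⟨b, fun _ e => e⟩),
      M.subst (node b ⟨U, hU⟩ c) = DTree.bind V fun j e => M.subst (c j e) := by
    rintro U _ rfl c V h h'
    have : V = M.readdress U (fun _ e => e) := by
      apply M.tree_ext
      · rw [h, eraseLeaf_readdress]
        exact (bind_unit U).symm
      · rw [h', contract_readdress]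
    rw [this]
    rfl
  exact key U.1 b U.2 c V h h'

theorem contract_cast_readdress {b : M.X.Op i} (U : M.Deco X ⟨i, b⟩) :
    M.contract (M.readdress U.1 (W := M.X.In b) fun j e =>
        cast (congrArg (fun b => M.X.In b j) U.2) e) = ⟨b, fun _ e => e⟩ := by
  have key : ∀ (U : DTree M.X X (fun _ => PUnit) i) (b : M.X.Op i) (hU : M.target U = b),
      M.contract (M.readdress U (W := M.X.In b) fun j e =>
        cast (congrArg (fun b => M.X.In b j) hU) e) = ⟨b, fun _ e => e⟩ := by
    rintro U _ rfl
    exact M.contract_readdress _ _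
  exact key U.1 b U.2

theorem contract_subst (T : DTree M.X (M.Deco X) Z i) :
    M.contract (M.subst T) = M.contract T := by
  induction T with
  | leaf z => rfl
  | node b U c ih =>
    simp only [subst, contract_bind, contract_cast_readdress, ih]
    rfl

theorem subst_bind (T : DTree M.X (M.Deco X) Z i) (k : ∀ j, Z j → DTree M.X (M.Deco X) W j) :
    M.subst (DTree.bind T k) = DTree.bind (M.subst T) fun j z => M.subst (k j z) := by
  induction T with
  | leaf z => rfl
  | node b U c ih => simp only [subst, DTree.bind, ih, bind_bind]

/-- Functoriality of `Deco`. -/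
def mapDeco (f : ∀ a, X a → Y a) (a : Σ i, M.X.Op i) (U : M.Deco X a) : M.Deco Y a :=
  ⟨mapNode f U.1, (congrArg Sigma.fst (M.contract_mapNode f U.1)).trans U.2⟩

/-- Substitution preserves targets. -/
noncomputable def substDeco (a : Σ i, M.X.Op i) (U : M.Deco (M.Deco X) a) : M.Deco X a :=
  ⟨M.subst U.1, (congrArg Sigma.fst (M.contract_subst U.1)).trans U.2⟩

theorem eraseLeaf_self (U : DTree M.X X (fun _ => PUnit) i) : eraseLeaf U = U := bind_unit U

theorem mapNode_subst (f : ∀ a, X a → Y a) (T : DTree M.X (M.Deco X) Z i) :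
    mapNode f (M.subst T) = M.subst (mapNode (M.mapDeco f) T) := by
  induction T with
  | leaf z => rfl
  | node b U c ih =>
    rw [mapNode, M.subst_node (M.mapDeco f _ U) _ (mapNode f (M.readdress U.1 (W := M.X.In b)
      fun j e => cast (congrArg (fun b => M.X.In b j) U.2) e))]
    · simp only [subst, mapNode_bind, ih]
    · have := congrArg (mapNode f) (M.eraseLeaf_readdress U.1 (W := M.X.In b)
        fun j e => cast (congrArg (fun b => M.X.In b j) U.2) e)
      rw [eraseLeaf_self, eraseLeaf, mapNode_bind] at this
      exact this
    · rw [contract_mapNode, contract_cast_readdress]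

theorem subst_subst (T : DTree M.X (M.Deco (M.Deco X)) Z i) :
    M.subst (M.subst T) = M.subst (mapNode M.substDeco T) := by
  induction T with
  | leaf z => rfl
  | node b U c ih =>
    rw [mapNode, M.subst_node (M.substDeco _ U) _ (M.subst (M.readdress U.1 (W := M.X.In b)
      fun j e => cast (congrArg (fun b => M.X.In b j) U.2) e))]
    · rw [subst, subst_bind]
      simp only [ih]
    · have := congrArg M.subst (M.eraseLeaf_readdress U.1 (W := M.X.In b)
        fun j e => cast (congrArg (fun b => M.X.In b j) U.2) e)
      rw [eraseLeaf_self, eraseLeaf, subst_bind] at this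
      exact this
    · rw [contract_subst, contract_cast_readdress]

/-- The corolla at an operation `a` of `M`, with its only node decorated by `x`. -/
def corolla (a : Σ i, M.X.Op i) (x : X a) : M.Deco X a :=
  ⟨node a.2 x fun _ _ => leaf ⟨⟩,
    congrArg Sigma.fst (M.join_map_pure (⟨a.2, fun _ _ => ⟨⟩⟩ : M.X.eval (fun _ => PUnit) a.1))⟩

theorem subst_corolla (a : Σ i, M.X.Op i) (U : M.Deco X a) : M.subst (M.corolla a U).1 = U.1 := by
  change DTree.bind (M.readdress U.1 (W := M.X.In a.2) fun j e =>
        cast (congrArg (fun b => M.X.In b j) U.2) e) (fun _ _ => leaf ⟨⟩) = U.1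
  exact (M.eraseLeaf_readdress U.1 _).trans (M.eraseLeaf_self U.1)

theorem subst_map_corolla (T : DTree M.X X Z i) : M.subst (mapNode M.corolla T) = T := by
  induction T with
  | leaf z => rfl
  | @node i b x c ih =>
    rw [mapNode, M.subst_node (M.corolla _ x) _ (node b x fun _ e => leaf e)]
    · simp only [ih, DTree.bind]
    · rfl
    · exact M.join_map_pure (⟨b, fun _ e => e⟩ : M.X.eval (M.X.In b) i)

end contraction

section indexed

variable {X Y : (Σ i, M.X.Op i) → Type u} {Z W : I → Type u} {i : I}

/-- The nodes of `V`, with their decorations, are in a label-preserving bijection with `N` and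
`l`. -/
def Indexed {P : PolyEnd I} {X : (Σ i, P.Op i) → Type u} {Z : I → Type u} {i : I}
    (V : DTree P X Z i) (N : (Σ i, P.Op i) → Type u) (l : ∀ a, N a → X a) : Prop :=
  ∃ θ : ∀ a, N a ≃ Node (erase V) a, ∀ a n, label V a (θ a n) = l a n

theorem Indexed.congr {P : PolyEnd I} {X : (Σ i, P.Op i) → Type u} {Z : I → Type u} {i : I}
    {V : DTree P X Z i} {N N' : (Σ i, P.Op i) → Type u} {l : ∀ a, N a → X a} {l' : ∀ a, N' a → X a}
    (h : Indexed V N l) (f : ∀ a, N a → N' a) (hf : ∀ a, Function.Bijective (f a))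
    (hl : ∀ a n, l' a (f a n) = l a n) : Indexed V N' l' := by
  obtain ⟨θ, hθ⟩ := h
  refine ⟨fun a => (Equiv.ofBijective (f a) (hf a)).symm.trans (θ a), fun a n => ?_⟩
  obtain ⟨n, rfl⟩ := (hf a).2 n
  rw [hl, ← hθ]
  exact congrArg (fun n => label V a (θ a n))
    ((Equiv.ofBijective (f a) (hf a)).symm_apply_apply n)

theorem Indexed.node {P : PolyEnd I} {X : (Σ i, P.Op i) → Type u} {Z : I → Type u} {i : I}
    {b : P.Op i} (x : X ⟨i, b⟩) {c : ∀ j, P.In b j → DTree P X Z j}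
    {N : ∀ j, P.In b j → (Σ i, P.Op i) → Type u} {l : ∀ j e a, N j e a → X a}
    (h : ∀ j e, Indexed (c j e) (N j e) (l j e)) :
    Indexed (DTree.node b x c)
      (fun a => ULift.{u} (PLift ((⟨i, b⟩ : Σ i, P.Op i) = a)) ⊕ (Σ j, Σ e : P.In b j, N j e a))
      (fun a n => match n with
        | Sum.inl h => h.down.down ▸ x
        | Sum.inr n => l n.1 n.2.1 a n.2.2) := by
  choose θ hθ using h
  refine ⟨fun a => Equiv.sumCongr (Equiv.refl _)
    (Equiv.sigmaCongrRight fun j => Equiv.sigmaCongrRight fun e => θ j e a), ?_⟩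
  rintro a (h | ⟨j, e, n⟩)
  · rfl
  · exact hθ j e a n

theorem Indexed.decorate {P : PolyEnd I} {X Y : (Σ i, P.Op i) → Type u} {Z : I → Type u} {i : I}
    (T : DTree P X Z i) (y : ∀ a, Node T a → Y a) : Indexed (decorate T y) (Node T) y := by
  induction T with
  | leaf z => exact ⟨fun a => Equiv.refl PEmpty, fun a n => nomatch n⟩
  | node b x c ih =>
    refine (Indexed.node (y _ (Sum.inl ⟨⟨rfl⟩⟩)) fun j e =>
      ih j e fun a n => y a (Sum.inr ⟨j, e, n⟩)).congr
      (fun a n => n) (fun _ => Function.bijective_id) ?_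
    rintro a (⟨⟨⟨rfl⟩⟩⟩ | ⟨j, e, n⟩) <;> rfl

theorem Indexed.bind_readdress (U : DTree M.X X Z i) {W' : I → Type u}
    (g : ∀ j, M.X.In (M.target U) j → W j)
    (k : ∀ j, W j → DTree M.X X W' j) {N : ∀ j, W j → (Σ i, M.X.Op i) → Type u}
    {l : ∀ j e a, N j e a → X a} (h : ∀ j e, Indexed (k j e) (N j e) (l j e)) :
    Indexed (DTree.bind (M.readdress U g) k)
      (fun a => Node (erase U) a ⊕ (Σ j, Σ e : M.X.In (M.target U) j, N j (g j e) a))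
      (fun a n => match n with
        | Sum.inl n => label U a n
        | Sum.inr n => l n.1 (g n.1 n.2.1) a n.2.2) := by
  induction U with
  | @leaf i z =>
    refine (h i (g i ((inEquiv (MonObj.one : 𝟙_ (PolyEnd I) ⟶ M.X) ⟨⟩ i).symm ⟨⟨rfl⟩⟩))).congr
      (fun a n => Sum.inr ⟨i, _, n⟩) (fun a => ⟨fun n n' hn => ?_, ?_⟩) (fun a n => rfl)
    · have := eq_of_heq (Sigma.mk.inj (Sum.inr.inj hn)).2
      exact eq_of_heq (Sigma.mk.inj this).2
    · rintro (n | ⟨j, e, n⟩)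
      · nomatch n
      · obtain ⟨⟨⟨hj⟩⟩, rfl⟩ :=
          (inEquiv (MonObj.one : 𝟙_ (PolyEnd I) ⟶ M.X) ⟨⟩ j).symm.surjective e
        obtain rfl : i = j := hj
        exact ⟨n, rfl⟩
  | node b x c ih =>
    refine (Indexed.node x fun j e => ih j e _).congr
      (fun a n => match n with
        | Sum.inl h => Sum.inl (Sum.inl h)
        | Sum.inr ⟨j, e, Sum.inl n⟩ => Sum.inl (Sum.inr ⟨j, e, n⟩)
        | Sum.inr ⟨j, e, Sum.inr ⟨k, e', n⟩⟩ => Sum.inr ⟨k, _, n⟩) (fun a => ⟨?_, ?_⟩) ?_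
    · rintro (n | ⟨j, e, n | ⟨k, e', n⟩⟩) (n' | ⟨j', e₂, n' | ⟨k', e₂', n'⟩⟩) hn
      · exact congrArg Sum.inl (Sum.inl.inj (Sum.inl.inj hn))
      · nomatch Sum.inl.inj hn
      · nomatch hn
      · nomatch Sum.inl.inj hn
      · obtain ⟨rfl, h2⟩ := Sigma.mk.inj (Sum.inr.inj (Sum.inl.inj hn))
        obtain ⟨rfl, h3⟩ := Sigma.mk.inj (eq_of_heq h2)
        obtain rfl := eq_of_heq h3
        rfl
      · nomatch hn
      · nomatch hn
      · nomatch hn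
      · obtain ⟨rfl, h2⟩ := Sigma.mk.inj (Sum.inr.inj hn)
        obtain ⟨h3, h4⟩ := Sigma.mk.inj (eq_of_heq h2)
        have h5 := (inEquiv (MonObj.mul : M.X ⊗ M.X ⟶ M.X) _ k).symm.injective h3
        obtain ⟨rfl, h6⟩ := Sigma.mk.inj h5
        obtain ⟨rfl, h7⟩ := Sigma.mk.inj (eq_of_heq h6)
        obtain rfl := eq_of_heq h7
        obtain rfl := eq_of_heq h4
        rfl
    · rintro ((n | ⟨j, e, n⟩) | ⟨k, e, n⟩)
      · exact ⟨Sum.inl n, rfl⟩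
      · exact ⟨Sum.inr ⟨j, e, Sum.inl n⟩, rfl⟩
      · obtain ⟨⟨j, e₁, e₂⟩, rfl⟩ := (inEquiv (MonObj.mul : M.X ⊗ M.X ⟶ M.X)
          (⟨b, fun j e => M.target (c j e)⟩ : M.X.eval M.X.Op _) k).symm.surjective e
        exact ⟨Sum.inr ⟨j, e₁, Sum.inr ⟨k, e₂, n⟩⟩, rfl⟩
    · rintro a (n | ⟨j, e, n | ⟨k, e', n⟩⟩) <;> rfl

theorem Indexed.subst_decorate (T : DTree M.X Y Z i) (f : ∀ a, Node T a → M.Deco X a)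
    {N : ∀ a, Node T a → (Σ i, M.X.Op i) → Type u} {l : ∀ a n a', N a n a' → X a'}
    (h : ∀ a n, Indexed (f a n).1 (N a n) (l a n)) :
    Indexed (M.subst (DTree.decorate T f)) (fun a' => Σ a, Σ n : Node T a, N a n a')
      (fun a' m => l m.1 m.2.1 a' m.2.2) := by
  induction T with
  | leaf z =>
    exact ⟨fun a => ⟨fun n => (n.2.1 : PEmpty).elim, fun n => (n : PEmpty).elim,
      fun n => (n.2.1 : PEmpty).elim, fun n => (n : PEmpty).elim⟩, fun a n => (n.2.1 : PEmpty).elim⟩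
  | @node i b x c ih =>
    have key : ∀ (U : DTree M.X X (fun _ => PUnit) i) (b : M.X.Op i) (hU : M.target U = b)
        (N₀ : (Σ i, M.X.Op i) → Type u) (l₀ : ∀ a, N₀ a → X a) (_ : Indexed U N₀ l₀) (c' : ∀ j, M.X.In b j → DTree M.X (M.Deco X) Z j)
        (N' : ∀ j, M.X.In b j → (Σ i, M.X.Op i) → Type u) (l' : ∀ j e a, N' j e a → X a)
        (_ : ∀ j e, Indexed (M.subst (c' j e)) (N' j e) (l' j e)),
        Indexed (M.subst (DTree.node b ⟨U, hU⟩ c')) (fun a => N₀ a ⊕ (Σ j, Σ e, N' j e a))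
          (fun a n => match n with
            | Sum.inl n => l₀ a n
            | Sum.inr n => l' n.1 n.2.1 a n.2.2) := by
      rintro U _ rfl N₀ l₀ h₀ c' N' l' h'
      obtain ⟨θ, hθ⟩ := h₀
      refine (Indexed.bind_readdress M U (fun _ e => e) _ h').congr
        (fun a n => Sum.map (θ a).symm id n)
        (fun a => (Sum.map_bijective.2 ⟨(θ a).symm.bijective, Function.bijective_id⟩)) ?_
      rintro a (n | n)
      · exact (hθ a _).symm.trans (congrArg _ ((θ a).apply_symm_apply n))
      · rfl
    refine (key (f ⟨i, b⟩ (Sum.inl ⟨⟨rfl⟩⟩)).1 b (f ⟨i, b⟩ (Sum.inl ⟨⟨rfl⟩⟩)).2 _ _ (h _ _) _ _ _ fun j e =>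
      ih j e (fun a n => f a (Sum.inr ⟨j, e, n⟩)) fun a n => h a (Sum.inr ⟨j, e, n⟩)).congr
      (fun a' n => match n with
        | Sum.inl n => ⟨⟨i, b⟩, Sum.inl ⟨⟨rfl⟩⟩, n⟩
        | Sum.inr ⟨j, e, a, n, m⟩ => ⟨a, Sum.inr ⟨j, e, n⟩, m⟩) (fun a' => ⟨?_, ?_⟩) ?_
    · rintro (n | ⟨j, e, a, n, m⟩) (n' | ⟨j', e', a₂, n', m'⟩) hn
      · exact congrArg Sum.inl (eq_of_heq (Sigma.mk.inj (eq_of_heq (Sigma.mk.inj hn).2)).2)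
      · obtain ⟨rfl, h1⟩ := Sigma.mk.inj hn
        nomatch (Sigma.mk.inj (eq_of_heq h1)).1
      · obtain ⟨rfl, h1⟩ := Sigma.mk.inj hn
        nomatch (Sigma.mk.inj (eq_of_heq h1)).1
      · obtain ⟨rfl, h1⟩ := Sigma.mk.inj hn
        obtain ⟨h2, h3⟩ := Sigma.mk.inj (eq_of_heq h1)
        obtain ⟨rfl, h4⟩ := Sigma.mk.inj (Sum.inr.inj h2)
        obtain ⟨rfl, h5⟩ := Sigma.mk.inj (eq_of_heq h4)
        obtain rfl := eq_of_heq h5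
        obtain rfl := eq_of_heq h3
        rfl
    · rintro ⟨a, (⟨⟨⟨rfl⟩⟩⟩ | ⟨j, e, n⟩), m⟩
      · exact ⟨Sum.inl m, rfl⟩
      · exact ⟨Sum.inr ⟨j, e, a, n, m⟩, rfl⟩
    · rintro a' (n | ⟨j, e, a, n, m⟩) <;> rfl

end indexed

/-- An element of `M⁺(X)` as a tree with nodes decorated by `X`. -/
def toDeco {X : (Σ i, M.X.Op i) → Type u} {a : Σ i, M.X.Op i} (x : M.plus.eval X a) :
    M.Deco X a :=
  ⟨decorate x.1.1 x.2, (congrArg Sigma.fst (M.contract_decorate x.1.1 x.2)).trans x.1.2⟩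

theorem toDeco_inj {X : (Σ i, M.X.Op i) → Type u} {a : Σ i, M.X.Op i} {x y : M.plus.eval X a}
    (h : M.toDeco x = M.toDeco y) : x = y := by
  obtain ⟨⟨T, hT⟩, x⟩ := x
  obtain ⟨⟨T', hT'⟩, y⟩ := y
  have h1 : decorate T x = decorate T' y := congrArg Subtype.val h
  obtain rfl : T = T' := by
    exact (erase_decorate T x).symm.trans ((congrArg erase h1).trans (erase_decorate T' y))
  obtain rfl := decorate_inj T x y h1
  rfl

/-- The unit of `M⁺`: the operation `a` of `M` is sent to the corolla at `a`, which has one node. -/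
def plusOne : 𝟙_ (PolyEnd (Σ i, M.X.Op i)) ⟶ M.plus where
  onOp {a} _ := M.corolla a ⟨⟩
  onIn {a} _ a' n :=
    match (n : ULift (PLift (a = a')) ⊕ (Σ j, Σ _ : M.X.In a.2 j, PEmpty)) with
    | Sum.inl h => h
    | Sum.inr n => nomatch n.2.2
  cartesian {a} _ a' := by
    constructor
    · rintro (n | n) (n' | n') h
      · exact congrArg Sum.inl h
      · nomatch n'.2.2
      · nomatch n.2.2
      · nomatch n'.2.2
    · intro h
      exact ⟨Sum.inl h, rfl⟩

/-- An operation of `M⁺ ∘ M⁺` is an `M`-tree `T` with an `M`-tree `U_n` with target `b` for each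
node `n` of `T`, labelled `b`. This is `T` with `n` decorated by `U_n`, where moreover each node `m`
of `U_n` is decorated by the pair `(n, m)`. -/
def twoLevel {a : Σ i, M.X.Op i} (x : (M.plus.comp M.plus).Op a) :
    M.Deco (M.Deco ((M.plus.comp M.plus).In x)) a :=
  M.toDeco ⟨x.1, fun a' n => M.toDeco ⟨x.2 a' n, fun _ m => ⟨a', n, m⟩⟩⟩

/-- The multiplication of `M⁺`: substitute each `U_n` for the node `n` of `T`. The nodes of the
resulting tree correspond to the pairs `(n, m)`, with `m` a node of `U_n`. -/
noncomputable def plusMul : M.plus ⊗ M.plus ⟶ M.plus where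
  onOp x := ⟨erase (M.subst (M.twoLevel x).1), by
    have := (congrArg Sigma.fst (M.contract_mapNode (fun _ _ => PUnit.unit) (M.subst (M.twoLevel x).1)))
    rw [contract_subst] at this
    exact this.trans (M.twoLevel x).2⟩
  onIn x := label (M.subst (M.twoLevel x).1)
  cartesian x a := by
    obtain ⟨θ, hθ⟩ := Indexed.subst_decorate M x.1.1
      (fun a' n => M.toDeco (X := (M.plus.comp M.plus).In x) ⟨x.2 a' n, fun _ m => ⟨a', n, m⟩⟩)
      (N := fun a' n => Node (x.2 a' n).1) (l := fun a' n _ m => ⟨a', n, m⟩)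
      (fun a' n => Indexed.decorate (x.2 a' n).1
        (Y := (M.plus.comp M.plus).In x) (fun _ m => ⟨a', n, m⟩))
    refine ((θ a).bijective.of_comp_iff _).1 ?_
    have : label (M.subst (M.twoLevel x).1) a ∘ θ a = id := funext fun n => hθ a n
    have hb : Function.Bijective (label (M.subst (M.twoLevel x).1) a ∘ θ a) :=
      this.symm ▸ Function.bijective_id
    exact hb

theorem toDeco_one {X : (Σ i, M.X.Op i) → Type u} {a : Σ i, M.X.Op i} (x : X a) :
    M.toDeco (Hom.app M.plusOne (ofUnit x)) = M.corolla a x := rfl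

theorem toDeco_mul {X : (Σ i, M.X.Op i) → Type u} {a : Σ i, M.X.Op i}
    (x : M.plus.eval (M.plus.eval X) a) :
    M.toDeco (Hom.app M.plusMul (flatten x))
      = M.substDeco a (M.toDeco (M.plus.evalMap (fun _ => M.toDeco) x)) := by
  apply Subtype.ext
  have key : ∀ (W : DTree M.X ((M.plus.comp M.plus).In (flatten x).1) (fun _ => PUnit) a.1),
      decorate (erase W) (fun a' n => (flatten x).2 a' (label W a' n)) = mapNode (flatten x).2 W := by
    intro W
    conv_rhs => rw [← decorate_label W, mapNode_decorate]
  refine (key _).trans ?_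
  rw [mapNode_subst]
  refine congrArg M.subst ?_
  refine (mapNode_decorate _ _ _).trans ?_
  refine congrArg (decorate x.1.1) ?_
  funext a' n
  apply Subtype.ext
  exact mapNode_decorate _ _ _

theorem toDeco_map {X Y : (Σ i, M.X.Op i) → Type u} {a : Σ i, M.X.Op i} (f : ∀ a, X a → Y a)
    (x : M.plus.eval X a) : M.toDeco (M.plus.evalMap f x) = M.mapDeco f a (M.toDeco x) :=
  Subtype.ext (mapNode_decorate x.1.1 x.2 f).symm

theorem eq_ofUnit {J : Type u} {Z : J → Type u} {i : J} (v : (unit J).eval Z i) :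
    v = ofUnit (v.2 i ⟨⟨rfl⟩⟩) := by
  refine congrArg (Sigma.mk _) (funext fun j => funext fun h => ?_)
  obtain ⟨⟨rfl⟩⟩ := h
  rfl

/-- The action of the multiplication of `M⁺` on values. -/
noncomputable def plusJoin {X : (Σ i, M.X.Op i) → Type u} {a : Σ i, M.X.Op i}
    (x : M.plus.eval (M.plus.eval X) a) : M.plus.eval X a :=
  Hom.app M.plusMul (flatten x)

theorem plusJoin_one {X : (Σ i, M.X.Op i) → Type u} {a : Σ i, M.X.Op i} (x : M.plus.eval X a) :
    M.plusJoin (Hom.app M.plusOne (ofUnit x)) = x := by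
  apply M.toDeco_inj
  rw [plusJoin, toDeco_mul]
  exact Subtype.ext (M.subst_corolla a (M.toDeco x))

theorem plusJoin_map_one {X : (Σ i, M.X.Op i) → Type u} {a : Σ i, M.X.Op i}
    (x : M.plus.eval X a) :
    M.plusJoin (M.plus.evalMap (fun _ z => Hom.app M.plusOne (ofUnit z)) x) = x := by
  apply M.toDeco_inj
  rw [plusJoin, toDeco_mul]
  change M.substDeco a (M.toDeco (M.plus.evalMap M.corolla x)) = _
  rw [toDeco_map]
  exact Subtype.ext (M.subst_map_corolla (M.toDeco x).1)

theorem plusJoin_plusJoin {X : (Σ i, M.X.Op i) → Type u} {a : Σ i, M.X.Op i}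
    (x : M.plus.eval (M.plus.eval (M.plus.eval X)) a) :
    M.plusJoin (M.plusJoin x) = M.plusJoin (M.plus.evalMap (fun _ => M.plusJoin) x) := by
  have h : ∀ {X : (Σ i, M.X.Op i) → Type u} (a : Σ i, M.X.Op i)
      (y : M.plus.eval (M.plus.eval X) a),
      M.toDeco (M.plusJoin y) = M.substDeco a (M.toDeco (M.plus.evalMap (fun _ => M.toDeco) y)) :=
    fun a y => M.toDeco_mul y
  apply M.toDeco_inj
  have e : M.plus.evalMap (fun _ => M.toDeco) (M.plus.evalMap (fun _ => M.plusJoin) x)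
      = M.plus.evalMap M.substDeco (M.plus.evalMap (M.mapDeco fun _ => M.toDeco)
        (M.plus.evalMap (fun _ => M.toDeco) x)) :=
    congrArg (Sigma.mk _) (funext fun j => funext fun e =>
      (h j _).trans (congrArg (M.substDeco j) (M.toDeco_map (fun _ => M.toDeco) _)))
  rw [h a (M.plusJoin x), h a (M.plus.evalMap _ x), e,
    M.toDeco_map (fun _ => M.toDeco) (M.plusJoin x), h a x, M.toDeco_map M.substDeco,
    M.toDeco_map (M.mapDeco _)]
  apply Subtype.ext
  change M.subst (mapNode _ (M.subst _)) = M.subst (mapNode _ (mapNode _ _))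
  rw [mapNode_subst, subst_subst]

/-- The Baez--Dolan construction `M⁺`, a polynomial monad over the set of operations of `M`. -/
noncomputable def baezDolan : PolyMnd (Σ i, M.X.Op i) where
  X := M.plus
  mon :=
    { one := M.plusOne
      mul := M.plusMul
      one_mul := Hom.ext_app fun a x => by
        have h := eq_ofUnit (⟨x.1, fun j h => ⟨x.2 j h, fun k e => ⟨j, h, e⟩⟩⟩ :
          (unit _).eval (M.plus.eval (((unit _).comp M.plus).In x)) a)
        have h' : (⟨x, fun _ e => e⟩ : ((unit _).comp M.plus).eval _ a) = _ := congrArg flatten h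
        exact (congrArg (Hom.app (M.plusOne ▷ M.plus ≫ M.plusMul)) h').trans (M.plusJoin_one _)
      mul_one := Hom.ext_app fun a x => by
        have h : (fun j e => ⟨⟨⟩, fun k h => ⟨j, e, h⟩⟩ : ∀ j, M.plus.In x.1 j →
            (unit _).eval ((M.plus.comp (unit _)).In x) j)
            = fun j e => ofUnit ⟨j, e, ⟨⟨rfl⟩⟩⟩ :=
          funext fun j => funext fun e => eq_ofUnit _
        have h' : (⟨x, fun _ e => e⟩ : (M.plus.comp (unit _)).eval _ a) = _ :=
          congrArg (fun y => flatten (⟨x.1, y⟩ : M.plus.eval ((unit _).eval _) a)) h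
        exact (congrArg (Hom.app (M.plus ◁ M.plusOne ≫ M.plusMul)) h').trans
          (M.plusJoin_map_one
            (⟨x.1, fun j e => (⟨j, e, ⟨⟨rfl⟩⟩⟩ : (M.plus.comp (unit _)).In x j)⟩ :
              M.plus.eval ((M.plus.comp (unit _)).In x) a))
      mul_assoc := Hom.ext_app fun a x => 
        M.plusJoin_plusJoin (⟨x.1.1, fun j e => ⟨x.1.2 j e, fun k e' => ⟨x.2 k ⟨j, e, e'⟩,
          fun l e'' => ⟨k, ⟨j, e, e'⟩, e''⟩⟩⟩⟩ :
          M.plus.eval (M.plus.eval (M.plus.eval (((M.plus.comp M.plus).comp M.plus).In x))) a) }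

end PolyMnd

/-! A morphism of polynomial endofunctors is cartesian, so an endofunctor `N` over `M` is determined
by the sets of operations of `N` lying over each operation of `M`; the inputs are pulled back from
`M`. Thus endofunctors over `M` amount to families over the set `B` of operations of `M`. A monad
structure on `N` compatible with `M` then amounts to an action of `M⁺` on this family: an `M`-tree
whose nodes are decorated by operations of `N` over their labels can be contracted in `N`, and the
result lies over the target of the tree.

This gives `fibreFunctor` from `Over M` to algebras. It is faithful because a cartesian map over `M`
is known once its effect on operations is. It is full because the unit and the multiplication of `N`
are contractions of particular trees, a bare edge and a two-level tree, so a map that respects all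
contractions respects both (`app_contractOver_homOfFibreMap`, `contractOver_bind_corollaOver`). It
is essentially surjective because an algebra `A` yields a monad whose operations over `b` are the
elements of `A_b`, with unit and multiplication read off from the same trees. The monad laws follow
from `treeVal_bind`, which says that a grafted tree may be evaluated in stages; this is the
associativity of `A` applied to a tree of trees.

Explicit bijections between leaves and inputs are mostly avoided by letting leaves carry arbitrary
decorations. Equality of values is checked on the operation and on the image in `M`
(`Hom.eq_of_app`), and morphisms are compared on generic elements, where each input is decorated by
itself. -/

namespace PolyEnd

/-! ### Cartesianness of morphisms, expressed on values -/

variable {I : Type u} {P Q : PolyEnd I} {Z : I → Type u} {i : I}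

/-- Inputs of an operation biject with those of its image, so no decoration is lost under `F`. With
`F` a projection to `M`, this is the main equality test below. -/
theorem Hom.eq_of_app (F : P ⟶ Q) {x y : P.eval Z i} (h : x.1 = y.1)
    (h' : Hom.app F x = Hom.app F y) : x = y := by
  obtain ⟨b, x⟩ := x
  obtain ⟨c, y⟩ := y
  obtain rfl : b = c := h
  refine congrArg (Sigma.mk b) (funext fun j => funext fun e => ?_)
  obtain ⟨e, rfl⟩ := (Hom.cartesian F b j).2 e
  exact congrFun (congrFun (eq_of_heq (Sigma.mk.inj h').2) j) e

/-- The naturality squares of a morphism of polynomial functors are cartesian: an element of `Q(Z)`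
lifts to `P(Z)` along each lift of its underlying operation. -/
noncomputable def Hom.lift (F : P ⟶ Q) (b : P.Op i) (y : Q.eval Z i) (h : Hom.onOp F b = y.1) :
    P.eval Z i :=
  ⟨b, fun j e => y.2 j (cast (congrArg (fun c => Q.In c j) h) ((inEquiv F b j).symm e))⟩

theorem Hom.app_lift (F : P ⟶ Q) (b : P.Op i) (y : Q.eval Z i) (h : Hom.onOp F b = y.1) :
    Hom.app F (Hom.lift F b y h) = y := by
  obtain ⟨c, y⟩ := y
  obtain rfl : Hom.onOp F b = c := h
  refine congrArg (Sigma.mk _) (funext fun j => funext fun e => congrArg (y j) ?_)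
  exact (inEquiv F b j).symm_apply_apply e

theorem Hom.eq_lift (F : P ⟶ Q) (x : P.eval Z i) :
    x = Hom.lift F x.1 (Hom.app F x) rfl :=
  Hom.eq_of_app F rfl (Hom.app_lift F _ _ _).symm

/-- A morphism of polynomial functors given by the images of the generic elements. -/
def Hom.ofGeneric (q : ∀ {i : I} (b : P.Op i), Q.eval (P.In b) i)
    (hq : ∀ {i : I} (b : P.Op i) (j : I), Function.Bijective ((q b).2 j)) : P ⟶ Q where
  onOp b := (q b).1
  onIn b := (q b).2
  cartesian := hq

/-- Supplies cartesianness for `Hom.ofGeneric`: it suffices to know the image of a generic element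
in a polynomial where bijectivity is already available. -/
theorem Hom.bijective_of_app (F : P ⟶ Q) (x : P.eval Z i) {y : Q.eval Z i} (h : Hom.app F x = y)
    (j : I) (hy : Function.Bijective (y.2 j)) : Function.Bijective (x.2 j) := by
  subst h
  exact ((Hom.cartesian F x.1 j).of_comp_iff _).1 hy

end PolyEnd

namespace PolyMnd

open PolyEnd DTree

/-! ### Contraction in a monad over `M`, and the resulting action on fibres -/

section fibres

variable {I : Type u} {M N N' : PolyMnd I} {Z W : I → Type u} {i : I}

theorem app_pure (f : N ⟶ M) (z : Z i) : Hom.app f.hom (N.pure z) = M.pure z :=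
  congrArg (fun F => Hom.app F (ofUnit z)) (IsMonHom.one_hom f.hom)

theorem app_join (f : N ⟶ M) (x : N.X.eval (N.X.eval Z) i) :
    Hom.app f.hom (N.join x)
      = M.join (M.X.evalMap (fun _ => Hom.app f.hom) (Hom.app f.hom x)) :=
  congrArg (fun F => Hom.app F (flatten x : (N.X.comp N.X).eval Z i)) (IsMonHom.mul_hom f.hom)

/-- The fibres of a morphism of polynomial monads, over the operations of its target. -/
abbrev Fibre (f : N ⟶ M) (a : Σ i, M.X.Op i) : Type u :=
  {n : N.X.Op a.1 // Hom.onOp f.hom n = a.2}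

/-- Contraction in `N` of an `M`-tree with nodes decorated by operations of `N` over their
labels. -/
noncomputable def contractOver (f : N ⟶ M) :
    ∀ {i : I}, DTree M.X (Fibre f) Z i → N.X.eval Z i
  | _, leaf z => N.pure z
  | _, node b x c => N.join (Hom.lift f.hom x.1 ⟨b, fun j e => contractOver f (c j e)⟩ x.2)

/-- Since `f` preserves unit and multiplication, contraction in `N` covers contraction in `M`. In
particular the result lies over the target, as `act` requires. -/
theorem app_contractOver (f : N ⟶ M) (T : DTree M.X (Fibre f) Z i) :
    Hom.app f.hom (contractOver f T) = M.contract T := by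
  induction T with
  | leaf z => exact app_pure f z
  | node b x c ih =>
    refine (app_join f _).trans ((congrArg (fun y => M.join (M.X.evalMap _ y))
      (Hom.app_lift f.hom x.1 _ x.2)).trans ?_)
    exact congrArg (fun w => M.join ⟨b, w⟩) (funext fun j => funext fun e => ih j e)

theorem contractOver_bind (f : N ⟶ M) (T : DTree M.X (Fibre f) Z i)
    (k : ∀ j, Z j → DTree M.X (Fibre f) W j) :
    contractOver f (DTree.bind T k)
      = N.join (N.X.evalMap (fun j z => contractOver f (k j z)) (contractOver f T)) := by
  induction T with
  | leaf z => rw [DTree.bind, contractOver, map_pure, join_pure]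
  | node b x c ih =>
    simp only [DTree.bind, contractOver, ih]
    exact (N.join_join (Hom.lift f.hom x.1 ⟨b, fun j e =>
      N.X.evalMap (fun j z => contractOver f (k j z)) (contractOver f (c j e))⟩ x.2)).symm

/-- Forgetting leaf decorations is grafting bare edges, which the right unit law absorbs. This moves
statements between trees with plain leaves, on which `M⁺` acts, and trees with decorated leaves, on
which induction runs. -/
theorem contractOver_eraseLeaf_fst (f : N ⟶ M) (T : DTree M.X (Fibre f) Z i) :
    (contractOver f (eraseLeaf T)).1 = (contractOver f T).1 := by
  rw [eraseLeaf, contractOver_bind]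
  exact congrArg Sigma.fst
    (N.join_map_pure (N.X.evalMap (fun _ _ => PUnit.unit) (contractOver f T)))

/-- The action of `M`-trees on the fibres of a morphism `N ⟶ M`. -/
noncomputable def act (f : N ⟶ M) (a : Σ i, M.X.Op i) (U : M.Deco (Fibre f) a) : Fibre f a :=
  ⟨(contractOver f U.1).1, (congrArg Sigma.fst (app_contractOver f U.1)).trans U.2⟩

theorem act_corolla (f : N ⟶ M) (a : Σ i, M.X.Op i) (x : Fibre f a) :
    act f a (M.corolla a x) = x :=
  Subtype.ext (congrArg Sigma.fst (N.join_map_pure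
    (Hom.lift f.hom x.1 (⟨a.2, fun _ _ => ⟨⟩⟩ : M.X.eval (fun _ => PUnit) a.1) x.2)))

/-- This is the associativity of the action. At a node decorated by a tree `U`, both sides multiply
the same contracted subtrees, so only the outer factors need comparison: they have the same
operation of `N` and the same image in `M`. -/
theorem contractOver_subst (f : N ⟶ M) (T : DTree M.X (M.Deco (Fibre f)) Z i) :
    contractOver f (M.subst T) = contractOver f (mapNode (act f) T) := by
  induction T with
  | leaf z => rfl
  | @node i b U c ih =>
    rw [subst, contractOver_bind, mapNode, contractOver]
    simp only [ih]
    -- Readdressing changes only leaf decorations, so the operation of `N` is that of `act f _ U`.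
    have h := contractOver_eraseLeaf_fst f (M.readdress U.1 (W := M.X.In b) fun j e =>
      cast (congrArg (fun b => M.X.In b j) U.2) e)
    rw [eraseLeaf_readdress, eraseLeaf_self] at h
    -- In `M` the readdressed tree contracts to the generic element of `b`, so each subtree sits at
    -- its own input.
    have h' := app_contractOver f (M.readdress U.1 (W := M.X.In b) fun j e =>
      cast (congrArg (fun b => M.X.In b j) U.2) e)
    rw [contract_cast_readdress] at h'
    refine congrArg N.join (Hom.eq_of_app f.hom h.symm ?_)
    exact (congrArg (M.X.evalMap fun j z => contractOver f (mapNode (act f) (c j z))) h').trans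
      (Hom.app_lift f.hom (act f _ U).1
        ⟨b, fun j e => contractOver f (mapNode (act f) (c j e))⟩ (act f _ U).2).symm

theorem act_substDeco (f : N ⟶ M) (a : Σ i, M.X.Op i) (U : M.Deco (M.Deco (Fibre f)) a) :
    act f a (M.substDeco a U) = act f a (M.mapDeco (act f) a U) :=
  Subtype.ext (congrArg Sigma.fst (contractOver_subst f U.1))

/-- The map on fibres induced by a morphism over `M`. -/
def fibreMap (f : N ⟶ M) (f' : N' ⟶ M) (g : N ⟶ N') (h : g ≫ f' = f) (a : Σ i, M.X.Op i)
    (x : Fibre f a) : Fibre f' a :=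
  ⟨Hom.onOp g.hom x.1, by subst h; exact x.2⟩

/-- Morphisms over `M` commute with contraction; at a node, two lifts with the same operation and
the same image in `M` are compared. -/
theorem contractOver_mapNode (f : N ⟶ M) (f' : N' ⟶ M) (g : N ⟶ N') (h : g ≫ f' = f)
    (T : DTree M.X (Fibre f) Z i) :
    contractOver f' (mapNode (fibreMap f f' g h) T) = Hom.app g.hom (contractOver f T) := by
  induction T with
  | leaf z => exact (app_pure g z).symm
  | node b x c ih =>
    rw [mapNode, contractOver, contractOver, app_join]
    simp only [ih]
    refine congrArg N'.join (Hom.eq_of_app f'.hom rfl ?_)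
    refine (Hom.app_lift f'.hom (fibreMap f f' g h _ x).1 _ (fibreMap f f' g h _ x).2).trans ?_
    subst h
    exact congrArg (M.X.evalMap fun _ => Hom.app g.hom)
      (Hom.app_lift (g ≫ f').hom x.1 ⟨b, fun j e => contractOver (g ≫ f') (c j e)⟩ x.2).symm

end fibres

/-! ### Algebras of `M⁺` as actions of decorated trees -/

section algebra

variable {I : Type u} (M : PolyMnd I)

/-- An element of `M⁺(X)` from a tree with nodes decorated by `X`. -/
def ofDeco {X : (Σ i, M.X.Op i) → Type u} {a : Σ i, M.X.Op i} (U : M.Deco X a) :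
    M.plus.eval X a :=
  ⟨⟨erase U.1, (congrArg Sigma.fst (M.contract_mapNode _ U.1)).trans U.2⟩, label U.1⟩

theorem toDeco_ofDeco {X : (Σ i, M.X.Op i) → Type u} {a : Σ i, M.X.Op i} (U : M.Deco X a) :
    M.toDeco (M.ofDeco U) = U :=
  Subtype.ext (decorate_label U.1)

theorem ofDeco_toDeco {X : (Σ i, M.X.Op i) → Type u} {a : Σ i, M.X.Op i} (x : M.plus.eval X a) :
    M.ofDeco (M.toDeco x) = x :=
  M.toDeco_inj (M.toDeco_ofDeco _)

/-- An algebra of `M⁺` from an action of decorated trees. -/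
noncomputable def algebraOfAct (X : (Σ i, M.X.Op i) → Type u) (act : ∀ a, M.Deco X a → X a)
    (act_corolla : ∀ a x, act a (M.corolla a x) = x)
    (act_subst : ∀ a U, act a (M.substDeco a U) = act a (M.mapDeco act a U)) :
    M.baezDolan.toMonad.Algebra where
  A := X
  a a := ↾(fun x => act a (M.toDeco x))
  unit := by
    funext a
    ext x
    exact act_corolla a x
  assoc := by
    funext a
    ext x
    have h : M.toDeco (M.plus.evalMap (fun a x => act a (M.toDeco x)) x)
        = M.mapDeco act a (M.toDeco (M.plus.evalMap (fun _ => M.toDeco) x)) :=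
      M.toDeco_map act (M.plus.evalMap (fun _ => M.toDeco) x)
    exact (congrArg (act a) (M.toDeco_mul x)).trans ((act_subst a _).trans
      (congrArg (act a) h.symm))

variable {M}

/-- The action of decorated trees on an algebra of `M⁺`. -/
def algebraAct (A : M.baezDolan.toMonad.Algebra) (a : Σ i, M.X.Op i) (U : M.Deco A.A a) : A.A a :=
  A.a a (M.ofDeco U)

theorem algebraAct_corolla (A : M.baezDolan.toMonad.Algebra) (a : Σ i, M.X.Op i) (x : A.A a) :
    algebraAct A a (M.corolla a x) = x := by
  have h := ConcreteCategory.congr_hom (congrFun A.unit a) x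
  refine (congrArg (A.a a) ?_).trans h
  exact M.ofDeco_toDeco (Hom.app M.plusOne (ofUnit x))

theorem algebraAct_substDeco (A : M.baezDolan.toMonad.Algebra) (a : Σ i, M.X.Op i)
    (U : M.Deco (M.Deco A.A) a) :
    algebraAct A a (M.substDeco a U) = algebraAct A a (M.mapDeco (algebraAct A) a U) := by
  -- The associativity law of `A`, taken at `U` read as an element of `M⁺(M⁺(A))`: the outer tree
  -- and each tree decorating it are converted separately.
  have h := ConcreteCategory.congr_hom (congrFun A.assoc a)
    (M.plus.evalMap (fun _ => M.ofDeco) (M.ofDeco U))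
  refine Eq.trans (congrArg (A.a a) ?_) (h.trans (congrArg (A.a a) ?_))
  · apply M.toDeco_inj
    refine Eq.trans ?_ (M.toDeco_mul _).symm
    rw [toDeco_ofDeco]
    refine congrArg (M.substDeco a) ?_
    have : M.plus.evalMap (fun _ => M.toDeco) (M.plus.evalMap (fun _ => M.ofDeco) (M.ofDeco U))
        = M.ofDeco U := congrArg (Sigma.mk _) (funext fun j => funext fun e => M.toDeco_ofDeco _)
    rw [this, toDeco_ofDeco]
  · apply M.toDeco_inj
    rw [toDeco_ofDeco]
    exact (M.toDeco_map (algebraAct A) (M.ofDeco U)).trans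
      (congrArg (M.mapDeco (algebraAct A) a) (M.toDeco_ofDeco U))

end algebra

/-! ### The fibre functor and its faithfulness -/

section comparison

variable {I : Type u} {M : PolyMnd I}

theorem algebraHom_act {A B : M.baezDolan.toMonad.Algebra} (φ : A ⟶ B) (a : Σ i, M.X.Op i)
    (U : M.Deco A.A a) :
    φ.f a (algebraAct A a U) = algebraAct B a (M.mapDeco (fun a => φ.f a) a U) := by
  have h := ConcreteCategory.congr_hom (congrFun φ.h a) (M.ofDeco U)
  refine h.symm.trans (congrArg (B.a a) (M.toDeco_inj ?_))
  exact (M.toDeco_map (fun a => φ.f a) (M.ofDeco U)).trans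
    ((congrArg (M.mapDeco _ a) (M.toDeco_ofDeco U)).trans (M.toDeco_ofDeco _).symm)

/-- A morphism of algebras of `M⁺` from a map that commutes with the actions of decorated trees. -/
def algebraHomOfAct {A B : M.baezDolan.toMonad.Algebra} (φ : ∀ a, A.A a → B.A a)
    (h : ∀ a U, φ a (algebraAct A a U) = algebraAct B a (M.mapDeco φ a U)) : A ⟶ B where
  f a := ↾(φ a)
  h := by
    funext a
    ext x
    refine Eq.trans ?_ ((h a (M.toDeco x)).symm.trans
      (congrArg (fun y => φ a (A.a a y)) (M.ofDeco_toDeco x)))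
    refine congrArg (B.a a) (M.toDeco_inj ?_)
    exact (M.toDeco_map φ x).trans (M.toDeco_ofDeco _).symm

section fibres

variable {N N' : PolyMnd I}

/-- The fibres of a morphism of polynomial monads `N ⟶ M`, as an algebra of `M⁺`. -/
noncomputable def fibreAlgebra (f : N ⟶ M) : M.baezDolan.toMonad.Algebra :=
  M.algebraOfAct (Fibre f) (act f) (act_corolla f) (act_substDeco f)

theorem algebraAct_fibreAlgebra (f : N ⟶ M) (a : Σ i, M.X.Op i) (U : M.Deco (Fibre f) a) :
    algebraAct (fibreAlgebra f) a U = act f a U :=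
  congrArg (act f a) (M.toDeco_ofDeco U)

/-- The functor that sends a polynomial monad over `M` to its fibres. -/
noncomputable def fibreFunctor (M : PolyMnd I) : Over M ⥤ M.baezDolan.toMonad.Algebra where
  obj N := fibreAlgebra N.hom
  map {N N'} g := algebraHomOfAct (fibreMap N.hom N'.hom g.left (Over.w g)) fun a U => by
    refine (congrArg (fibreMap N.hom N'.hom g.left (Over.w g) a)
      (algebraAct_fibreAlgebra N.hom a U)).trans
      (Eq.trans ?_ (algebraAct_fibreAlgebra N'.hom a _).symm)
    exact Subtype.ext (congrArg Sigma.fst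
      (contractOver_mapNode N.hom N'.hom g.left (Over.w g) U.1)).symm

instance : (fibreFunctor M).Faithful where
  map_injective {N N'} g g' h := by
    have h1 : ∀ {i : I} (n : N.left.X.Op i), Hom.onOp g.left.hom n = Hom.onOp g'.left.hom n :=
      fun {i} n => by
        -- Every operation belongs to the fibre over its own image, so equal maps on fibres give
        -- equal maps on operations.
        let x : Fibre N.hom ⟨i, Hom.onOp N.hom.hom n⟩ := ⟨n, rfl⟩
        have h2 := ConcreteCategory.congr_hom
          (congrFun (congrArg Monad.Algebra.Hom.f h) ⟨i, Hom.onOp N.hom.hom n⟩) x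
        exact congrArg Subtype.val h2
    refine Over.OverMorphism.ext (Mon.Hom.ext (Hom.ext_app fun i n => ?_))
    refine Hom.eq_of_app N'.hom.hom (h1 n) ?_
    change Hom.app (g.left ≫ N'.hom).hom _ = Hom.app (g'.left ≫ N'.hom).hom _
    rw [Over.w g, Over.w g']

/-! ### Fullness of the fibre functor -/

/-- The map on operations induced by a map on fibres. -/
def opMap {f : N ⟶ M} {f' : N' ⟶ M} (φ : ∀ a, Fibre f a → Fibre f' a) {i : I}
    (n : N.X.Op i) : N'.X.Op i :=
  (φ ⟨i, Hom.onOp f.hom n⟩ ⟨n, rfl⟩).1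

theorem opMap_over {f : N ⟶ M} {f' : N' ⟶ M} (φ : ∀ a, Fibre f a → Fibre f' a) {i : I}
    (n : N.X.Op i) : Hom.onOp f'.hom (opMap φ n) = Hom.onOp f.hom n :=
  (φ ⟨i, Hom.onOp f.hom n⟩ ⟨n, rfl⟩).2

theorem opMap_fibre {f : N ⟶ M} {f' : N' ⟶ M} (φ : ∀ a, Fibre f a → Fibre f' a)
    (a : Σ i, M.X.Op i) (x : Fibre f a) : opMap φ x.1 = (φ a x).1 := by
  -- The operation of `M` is made a variable, so that the equation placing `n` in the fibre can be
  -- eliminated.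
  have key : ∀ {i : I} (n : N.X.Op i) (b : M.X.Op i) (h : Hom.onOp f.hom n = b),
      opMap φ n = (φ ⟨i, b⟩ ⟨n, h⟩).1 := by
    rintro i n _ rfl
    rfl
  exact key x.1 a.2 x.2

/-- The morphism of polynomial functors induced by a map on fibres. -/
noncomputable def homOfFibreMap {f : N ⟶ M} {f' : N' ⟶ M} (φ : ∀ a, Fibre f a → Fibre f' a) :
    N.X ⟶ N'.X :=
  Hom.ofGeneric (fun n => Hom.lift f'.hom (opMap φ n)
      (Hom.app f.hom (⟨n, fun _ e => e⟩ : N.X.eval (N.X.In n) _)) (opMap_over φ n))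
    fun n j => Hom.bijective_of_app f'.hom _ (Hom.app_lift _ _ _ _) j (Hom.cartesian f.hom n j)

/-- True for generic elements by construction of the lift; any `x` is the image of a generic element
under its own decorations, and naturality does the rest. -/
theorem app_homOfFibreMap {f : N ⟶ M} {f' : N' ⟶ M} (φ : ∀ a, Fibre f a → Fibre f' a)
    {Z : I → Type u} {i : I} (x : N.X.eval Z i) :
    Hom.app f'.hom (Hom.app (homOfFibreMap φ) x) = Hom.app f.hom x :=
  congrArg (M.X.evalMap x.2) (Hom.app_lift f'.hom (opMap φ x.1)
    (Hom.app f.hom (⟨x.1, fun _ e => e⟩ : N.X.eval (N.X.In x.1) _)) (opMap_over φ x.1))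

theorem opMap_contractOver {f : N ⟶ M} {f' : N' ⟶ M} (φ : ∀ a, Fibre f a → Fibre f' a)
    (h : ∀ a U, φ a (act f a U) = act f' a (M.mapDeco φ a U)) {i : I}
    (T : DTree M.X (Fibre f) (fun _ => PUnit) i) :
    opMap φ (contractOver f T).1 = (contractOver f' (mapNode φ T)).1 :=
  (opMap_fibre φ ⟨i, M.target T⟩ (act f _ ⟨T, rfl⟩)).trans (congrArg Subtype.val (h _ _))

theorem mapNode_eraseLeaf {P : PolyEnd I} {X Y : (Σ i, P.Op i) → Type u} {Z : I → Type u}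
    (g : ∀ a, X a → Y a) {i : I} (V : DTree P X Z i) :
    mapNode g (eraseLeaf V) = eraseLeaf (mapNode g V) :=
  mapNode_bind g V _

/-- Extends the compatibility `h` from trees with plain leaves to all trees: the operation ignores
leaf decorations, and both sides have the same contraction in `M`. -/
theorem app_contractOver_homOfFibreMap {f : N ⟶ M} {f' : N' ⟶ M}
    (φ : ∀ a, Fibre f a → Fibre f' a)
    (h : ∀ a U, φ a (act f a U) = act f' a (M.mapDeco φ a U)) {Z : I → Type u} {i : I}
    (T : DTree M.X (Fibre f) Z i) :
    Hom.app (homOfFibreMap φ) (contractOver f T) = contractOver f' (mapNode φ T) := by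
  refine Hom.eq_of_app f'.hom ?_ ?_
  · refine (congrArg (opMap φ) (contractOver_eraseLeaf_fst f T).symm).trans ?_
    rw [opMap_contractOver φ h, mapNode_eraseLeaf, contractOver_eraseLeaf_fst]
  · rw [app_homOfFibreMap, app_contractOver, app_contractOver, contract_mapNode]

/-- The corolla decorated by an operation of `N`. -/
noncomputable def corollaOver (f : N ⟶ M) {Z : I → Type u} {i : I} (x : N.X.eval Z i) :
    DTree M.X (Fibre f) Z i :=
  node (Hom.onOp f.hom x.1) ⟨x.1, rfl⟩ fun j e => leaf ((Hom.app f.hom x).2 j e)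

theorem contractOver_corollaOver (f : N ⟶ M) {Z : I → Type u} {i : I} (x : N.X.eval Z i) :
    contractOver f (corollaOver f x) = x := by
  conv_rhs => rw [Hom.eq_lift f.hom x]
  exact N.join_map_pure (Hom.lift f.hom x.1 (Hom.app f.hom x) rfl)

/-- Exhibits every multiplication in `N` as the contraction of a two-level tree, so that preserving
contractions implies preserving multiplication. -/
theorem contractOver_bind_corollaOver (f : N ⟶ M) {Z : I → Type u} {i : I}
    (x : N.X.eval (N.X.eval Z) i) :
    contractOver f (DTree.bind (corollaOver f x) fun _ => corollaOver f) = N.join x := by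
  rw [contractOver_bind, contractOver_corollaOver]
  simp only [contractOver_corollaOver]
  rfl

theorem mapNode_corollaOver {f : N ⟶ M} {f' : N' ⟶ M} (φ : ∀ a, Fibre f a → Fibre f' a)
    {Z : I → Type u} {i : I} (x : N.X.eval Z i) :
    mapNode φ (corollaOver f x) = corollaOver f' (Hom.app (homOfFibreMap φ) x) := by
  have key : ∀ (y : M.X.eval Z i) (z : Fibre f' ⟨i, y.1⟩) (y' : M.X.eval Z i)
      (z' : Fibre f' ⟨i, y'.1⟩), y = y' → z.1 = z'.1 →
      (node y.1 z fun j e => leaf (y.2 j e) : DTree M.X (Fibre f') Z i)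
        = node y'.1 z' fun j e => leaf (y'.2 j e) := by
    rintro y z _ z' rfl h
    rw [Subtype.ext h]
  exact key (Hom.app f.hom x) _ (Hom.app f'.hom (Hom.app (homOfFibreMap φ) x)) ⟨_, rfl⟩
    (app_homOfFibreMap φ x).symm rfl

instance : (fibreFunctor M).Full where
  map_surjective {N N'} ψ := by
    let φ : ∀ a, Fibre N.hom a → Fibre N'.hom a := fun a => ψ.f a
    have h : ∀ a U, φ a (act N.hom a U) = act N'.hom a (M.mapDeco φ a U) := fun a U => by
      rw [← algebraAct_fibreAlgebra, ← algebraAct_fibreAlgebra]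
      exact algebraHom_act ψ a U
    -- The unit is the contraction of a bare edge.
    have hone : ∀ {Z : I → Type u} {i : I} (z : Z i),
        Hom.app (homOfFibreMap φ) (N.left.pure z) = N'.left.pure z :=
      fun z => app_contractOver_homOfFibreMap φ h (leaf z)
    have hmul : ∀ {Z : I → Type u} {i : I} (x : N.left.X.eval (N.left.X.eval Z) i),
        Hom.app (homOfFibreMap φ) (N.left.join x) = N'.left.join (N'.left.X.evalMap
          (fun _ => Hom.app (homOfFibreMap φ)) (Hom.app (homOfFibreMap φ) x)) := by
      intro Z i x
      rw [← contractOver_bind_corollaOver N.hom, app_contractOver_homOfFibreMap φ h,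
        mapNode_bind, mapNode_corollaOver, ← contractOver_bind_corollaOver N'.hom]
      simp only [mapNode_corollaOver]
      rfl
    let g : N.left ⟶ N'.left :=
      { hom := homOfFibreMap φ
        isMonHom_hom :=
          -- The generic element of the identity polynomial equals an `ofUnit` only after transport
          -- along an equality of colours, hence `eq_ofUnit` on both sides.
          { one_hom := Hom.ext_app fun i x =>
              (congrArg (Hom.app (MonObj.one ≫ homOfFibreMap φ))
                (eq_ofUnit (⟨x, fun _ e => e⟩ : (unit I).eval ((unit I).In x) i))).trans
                ((hone _).trans (congrArg (Hom.app MonObj.one)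
                  (eq_ofUnit (⟨x, fun _ e => e⟩ : (unit I).eval ((unit I).In x) i)).symm))
            mul_hom := Hom.ext_app fun i x =>
              hmul (⟨x.1, fun j e => ⟨x.2 j e, fun k e' => ⟨j, e, e'⟩⟩⟩ :
                N.left.X.eval (N.left.X.eval ((N.left.X.comp N.left.X).In x)) i) } }
    have hg : g ≫ N'.hom = N.hom := Mon.Hom.ext (Hom.ext_app fun i n => app_homOfFibreMap φ _)
    refine ⟨Over.homMk g hg, ?_⟩
    apply Monad.Algebra.Hom.ext
    funext a
    ext x
    exact Subtype.ext (opMap_fibre φ a x)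

end fibres

end comparison

/-! ### Polynomial monads from laws on values -/

variable {I : Type u}

/-- A polynomial monad from the laws of its unit and multiplication on values. -/
def ofLaws (P : PolyEnd I) (one : 𝟙_ (PolyEnd I) ⟶ P) (mul : P ⊗ P ⟶ P)
    (one_mul : ∀ {Z : I → Type u} {i : I} (x : P.eval Z i),
      Hom.app mul (flatten (Hom.app one (ofUnit x))) = x)
    (mul_one : ∀ {Z : I → Type u} {i : I} (x : P.eval Z i),
      Hom.app mul (flatten (P.evalMap (fun _ z => Hom.app one (ofUnit z)) x)) = x)
    (mul_assoc : ∀ {Z : I → Type u} {i : I} (x : P.eval (P.eval (P.eval Z)) i),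
      Hom.app mul (flatten (Hom.app mul (flatten x)))
        = Hom.app mul (flatten (P.evalMap (fun _ y => Hom.app mul (flatten y)) x))) :
    PolyMnd I where
  X := P
  mon :=
    { one := one
      mul := mul
      one_mul := Hom.ext_app fun a x => by
        have h := eq_ofUnit (⟨x.1, fun j h => ⟨x.2 j h, fun k e => ⟨j, h, e⟩⟩⟩ :
          (unit _).eval (P.eval (((unit _).comp P).In x)) a)
        have h' : (⟨x, fun _ e => e⟩ : ((unit _).comp P).eval _ a) = _ := congrArg flatten h
        exact (congrArg (Hom.app (one ▷ P ≫ mul)) h').trans (one_mul _)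
      mul_one := Hom.ext_app fun a x => by
        have h : (fun j e => ⟨⟨⟩, fun k h => ⟨j, e, h⟩⟩ : ∀ j, P.In x.1 j →
            (unit _).eval ((P.comp (unit _)).In x) j)
            = fun j e => ofUnit ⟨j, e, ⟨⟨rfl⟩⟩⟩ :=
          funext fun j => funext fun e => eq_ofUnit _
        have h' : (⟨x, fun _ e => e⟩ : (P.comp (unit _)).eval _ a) = _ :=
          congrArg (fun y => flatten (⟨x.1, y⟩ : P.eval ((unit _).eval _) a)) h
        exact (congrArg (Hom.app (P ◁ one ≫ mul)) h').trans
          (mul_one (⟨x.1, fun j e => (⟨j, e, ⟨⟨rfl⟩⟩⟩ : (P.comp (unit _)).In x j)⟩ :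
            P.eval ((P.comp (unit _)).In x) a))
      mul_assoc := Hom.ext_app fun a x =>
        mul_assoc (⟨x.1.1, fun j e => ⟨x.1.2 j e, fun k e' => ⟨x.2 k ⟨j, e, e'⟩,
          fun l e'' => ⟨k, ⟨j, e, e'⟩, e''⟩⟩⟩⟩ :
          P.eval (P.eval (P.eval (((P.comp P).comp P).In x))) a) }

/-! ### The polynomial monad over `M` built from an algebra of `M⁺` -/

section total

variable {M : PolyMnd I} (A : M.baezDolan.toMonad.Algebra) {Z W : I → Type u} {i : I}

/-- The polynomial endofunctor over `M` whose fibres are those of an algebra of `M⁺`. -/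
def total : PolyEnd I where
  Op i := Σ b : M.X.Op i, A.A ⟨i, b⟩
  In x j := M.X.In x.1 j
  finitary x := M.X.finitary x.1

/-- The projection to `M`. -/
def totalProj : total A ⟶ M.X where
  onOp x := x.1
  onIn _ _ e := e
  cartesian _ _ := Function.bijective_id

variable {A}

/-- The operation given by a decorated tree. -/
def treeOp (T : DTree M.X A.A (fun _ => PUnit) i) : (total A).Op i :=
  ⟨M.target T, algebraAct A ⟨i, M.target T⟩ ⟨T, rfl⟩⟩

theorem treeOp_eq {b : M.X.Op i} (U : M.Deco A.A ⟨i, b⟩) :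
    treeOp U.1 = ⟨b, algebraAct A ⟨i, b⟩ U⟩ := by
  have key : ∀ (T : DTree M.X A.A (fun _ => PUnit) i) (b : M.X.Op i) (h : M.target T = b),
      treeOp T = ⟨b, algebraAct A ⟨i, b⟩ ⟨T, h⟩⟩ := by
    rintro T _ rfl
    rfl
  exact key U.1 b U.2

/-- A decorated tree without the decorations of its leaves, as a tree with given target. -/
def eraseLeafDeco {X : (Σ i, M.X.Op i) → Type u} (T : DTree M.X X Z i) :
    M.Deco X ⟨i, M.target T⟩ :=
  ⟨eraseLeaf T, congrArg Sigma.fst (M.contract_eraseLeaf T)⟩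

/-- The value of a decorated tree. -/
def treeVal (T : DTree M.X A.A Z i) : (total A).eval Z i :=
  ⟨⟨M.target T, algebraAct A _ (eraseLeafDeco T)⟩, (M.contract T).2⟩

theorem treeVal_fst (T : DTree M.X A.A Z i) : (treeVal T).1 = treeOp (eraseLeaf T) :=
  (treeOp_eq (eraseLeafDeco T)).symm

theorem treeVal_eq {T : DTree M.X A.A Z i} {x : (total A).eval Z i}
    (h : treeOp (eraseLeaf T) = x.1) (h' : M.contract T = Hom.app (totalProj A) x) :
    treeVal T = x :=
  Hom.eq_of_app (totalProj A) ((treeVal_fst T).trans h) h'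

/-- On operations this is the associativity law of `A`; on the decorations of inputs it holds
because substitution preserves contraction in `M`. -/
theorem treeVal_subst (T : DTree M.X (M.Deco A.A) Z i) :
    treeVal (M.subst T) = treeVal (mapNode (algebraAct A) T) := by
  refine treeVal_eq ?_ ((M.contract_subst T).trans (M.contract_mapNode (algebraAct A) T).symm)
  rw [treeVal_fst, ← mapNode_eraseLeaf]
  have h : eraseLeaf (M.subst T) = M.subst (eraseLeaf T) := 
    (M.subst_bind T fun _ _ => leaf PUnit.unit).symm
  rw [h]
  refine (treeOp_eq (M.substDeco _ (eraseLeafDeco T))).trans ?_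
  rw [algebraAct_substDeco]
  exact (treeOp_eq (M.mapDeco (algebraAct A) _ (eraseLeafDeco T))).symm

theorem treeVal_bind_leaf (T : DTree M.X A.A Z i) (g : ∀ j, Z j → W j) :
    treeVal (DTree.bind T fun j z => leaf (g j z)) = (total A).evalMap g (treeVal T) := by
  refine treeVal_eq ?_ ?_
  · refine Eq.trans ?_ (treeVal_fst T).symm
    rw [eraseLeaf, bind_bind]
    rfl
  · rw [contract_bind]
    exact M.join_map_pure (M.X.evalMap g (M.contract T))

/-- The corolla of an element. -/
def treeOf (x : (total A).eval Z i) : DTree M.X A.A Z i :=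
  node x.1.1 x.1.2 fun j e => leaf (x.2 j e)

theorem treeVal_treeOf (x : (total A).eval Z i) : treeVal (treeOf x) = x := by
  refine treeVal_eq ((treeOp_eq (M.corolla ⟨i, x.1.1⟩ x.1.2)).trans ?_)
    (M.join_map_pure (Hom.app (totalProj A) x))
  exact congrArg (Sigma.mk x.1.1) (algebraAct_corolla A ⟨i, x.1.1⟩ x.1.2)

/-- A tree as the only node of a corolla. -/
def nest {X : (Σ i, M.X.Op i) → Type u} (T : DTree M.X X Z i) : DTree M.X (M.Deco X) Z i :=
  node (M.target T) (eraseLeafDeco T) fun j e => leaf ((M.contract T).2 j e)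

/-- The nested copy of `T` has plain leaves, but the leaves of the corolla keep the decorations at
the matching inputs of the target. Shape and contraction then determine the result, by `tree_ext`.
-/
theorem subst_nest {X : (Σ i, M.X.Op i) → Type u} (T : DTree M.X X Z i) :
    M.subst (nest T) = T := by
  rw [nest, M.subst_node (eraseLeafDeco T) _ (M.readdress T fun _ e => e)
    (M.eraseLeaf_readdress T _) (M.contract_readdress T _)]
  refine M.tree_ext _ _ ?_ ?_
  · rw [eraseLeaf, bind_bind]
    exact M.eraseLeaf_readdress T _
  · rw [contract_bind, contract_readdress]
    exact M.join_map_pure (M.contract T)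

/-- The multiplication on values: the value of a tree with two levels. -/
def totalJoin (x : (total A).eval ((total A).eval Z) i) : (total A).eval Z i :=
  treeVal (DTree.bind (treeOf x) fun _ => treeOf)

/-- The source of all the monad laws. In the two-level tree of nested trees, substituting first
gives the grafted tree, while acting on each decoration first gives the two-level tree that defines
`totalJoin`; `treeVal_subst` equates their values. -/
theorem treeVal_bind (T : DTree M.X A.A Z i) (k : ∀ j, Z j → DTree M.X A.A W j) :
    treeVal (DTree.bind T k)
      = totalJoin ((total A).evalMap (fun j z => treeVal (k j z)) (treeVal T)) := by
  have h := treeVal_subst (DTree.bind (nest T) fun j z => nest (k j z))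
  rw [subst_bind, mapNode_bind] at h
  simp only [subst_nest] at h
  exact h

theorem totalJoin_evalMap (x : (total A).eval ((total A).eval Z) i) (g : ∀ j, Z j → W j) :
    totalJoin ((total A).evalMap (fun _ => (total A).evalMap g) x)
      = (total A).evalMap g (totalJoin x) := by
  rw [totalJoin, totalJoin, ← treeVal_bind_leaf, bind_bind]
  rfl

theorem totalJoin_pure (x : (total A).eval Z i) : totalJoin (treeVal (leaf x)) = x := by
  have h := treeVal_bind (leaf x) fun _ => treeOf (A := A) (Z := Z)
  simp only [treeVal_treeOf] at h
  exact h.symm.trans (treeVal_treeOf x)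

theorem totalJoin_map_pure (x : (total A).eval Z i) :
    totalJoin ((total A).evalMap (fun _ z => treeVal (leaf z)) x) = x := by
  have h := treeVal_bind (treeOf x) fun _ z => leaf z
  rw [treeVal_treeOf] at h
  exact h.symm.trans (treeVal_treeOf x)

/-- Both sides evaluate one three-level tree, split below its second level or below its first. -/
theorem totalJoin_totalJoin (x : (total A).eval ((total A).eval ((total A).eval Z)) i) :
    totalJoin (totalJoin x) = totalJoin ((total A).evalMap (fun _ => totalJoin) x) := by
  have h := treeVal_bind (DTree.bind (treeOf x) fun _ => treeOf) fun _ => treeOf (A := A) (Z := Z)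
  have h' := treeVal_bind (treeOf x) fun _ y => DTree.bind (treeOf y) fun _ => treeOf
  rw [bind_bind] at h
  simp only [treeVal_treeOf] at h h'
  exact h.symm.trans h'

variable (A)

/-- Makes the projection multiplicative, and also lets `totalMul` inherit cartesianness from the
multiplication of `M`. -/
theorem app_totalProj_totalJoin (x : (total A).eval ((total A).eval Z) i) :
    Hom.app (totalProj A) (totalJoin x) = M.join (M.X.evalMap (fun _ => Hom.app (totalProj A))
      (Hom.app (totalProj A) x)) := by
  refine congrArg (fun y => M.join (⟨x.1.1, y⟩ : M.X.eval (M.X.eval Z) i))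
    (funext fun j => funext fun e => ?_)
  exact M.join_map_pure (Hom.app (totalProj A) (x.2 j e))

/-- The only input of the identity polynomial. -/
def unitIn (b : (unit I).Op i) : (unit I).In b i := ⟨⟨rfl⟩⟩

theorem app_totalProj_unitIn (b : (unit I).Op i) :
    Hom.app (totalProj A) (treeVal (leaf (unitIn b)))
      = Hom.app (P := unit I) (MonObj.one : 𝟙_ (PolyEnd I) ⟶ M.X) ⟨b, fun _ e => e⟩ :=
  congrArg (Hom.app (P := unit I) (MonObj.one : 𝟙_ (PolyEnd I) ⟶ M.X))
    (eq_ofUnit (⟨b, fun _ e => e⟩ : (unit I).eval ((unit I).In b) i)).symm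

/-- The unit of the polynomial monad given by an algebra of `M⁺`. -/
def totalOne : 𝟙_ (PolyEnd I) ⟶ total A :=
  Hom.ofGeneric (P := unit I) (fun b => treeVal (leaf (unitIn b)))
    fun b j => Hom.bijective_of_app (totalProj A) _ (app_totalProj_unitIn A b) j
      (Hom.cartesian (MonObj.one : 𝟙_ (PolyEnd I) ⟶ M.X) b j)

theorem app_totalOne (z : Z i) : Hom.app (totalOne A) (ofUnit z) = treeVal (leaf z) :=
  (treeVal_bind_leaf (A := A) (leaf (unitIn (i := i) ⟨⟩)) (ofUnit z).2).symm

/-- The multiplication of the polynomial monad given by an algebra of `M⁺`. -/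
def totalMul : total A ⊗ total A ⟶ total A :=
  Hom.ofGeneric (P := (total A).comp (total A))
    (fun x => totalJoin ⟨x.1, fun j e => ⟨x.2 j e, fun _ e' => ⟨j, e, e'⟩⟩⟩)
    fun x j => Hom.bijective_of_app (totalProj A) _ (y := Hom.app (P := M.X.comp M.X) MonObj.mul
        ⟨⟨x.1.1, fun j e => (x.2 j e).1⟩, fun _ e => e⟩) 
      (app_totalProj_totalJoin A _) j
      (Hom.cartesian (MonObj.mul : M.X ⊗ M.X ⟶ M.X)
        (⟨x.1.1, fun j e => (x.2 j e).1⟩ : (M.X.comp M.X).Op _) j)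

/-- `totalMul` is prescribed on generic elements only; naturality of `totalJoin` in the leaf
decorations gives the formula everywhere. -/
theorem app_totalMul (x : (total A).eval ((total A).eval Z) i) :
    Hom.app (totalMul A) (flatten x) = totalJoin x :=
  (totalJoin_evalMap (A := A) (⟨x.1, fun j e => ⟨(x.2 j e).1, fun _ e' => ⟨j, e, e'⟩⟩⟩ :
    (total A).eval ((total A).eval (((total A).comp (total A)).In (flatten x).1)) i)
    (flatten x).2).symm

/-- The polynomial monad given by an algebra of `M⁺`. -/
def totalMnd : PolyMnd I :=
  ofLaws (total A) (totalOne A) (totalMul A)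
    (fun x => by rw [app_totalOne, app_totalMul, totalJoin_pure])
    (fun x => by simp only [app_totalOne, app_totalMul, totalJoin_map_pure])
    (fun x => by simp only [app_totalMul, totalJoin_totalJoin])

/-- The projection to `M`, as a morphism of polynomial monads. -/
def totalMndProj : totalMnd A ⟶ M where
  hom := totalProj A
  isMonHom_hom :=
    { one_hom := Hom.ext_app fun _ x =>
        app_totalProj_unitIn A x
      mul_hom := Hom.ext_app fun i x =>
        app_totalProj_totalJoin A (⟨x.1, fun j e => ⟨x.2 j e, fun _ e' => ⟨j, e, e'⟩⟩⟩ :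
          (total A).eval ((total A).eval (((total A).comp (total A)).In x)) i) }

/-- The comparison of an algebra of `M⁺` with the fibres of its polynomial monad. -/
def toFibre (a : Σ i, M.X.Op i) (x : A.A a) : Fibre (totalMndProj A) a :=
  ⟨⟨a.2, x⟩, rfl⟩

theorem toFibre_bijective (a : Σ i, M.X.Op i) : Function.Bijective (toFibre A a) := by
  constructor
  · intro x y h
    exact eq_of_heq (Sigma.mk.inj (congrArg Subtype.val h)).2
  · rintro ⟨⟨b, x⟩, h⟩
    have key : ∀ (i : I) (b : M.X.Op i) (x : A.A ⟨i, b⟩) (b' : M.X.Op i) (h : b = b'),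
        ∃ y, toFibre A ⟨i, b'⟩ y = ⟨⟨b, x⟩, h⟩ := by
      rintro i b x _ rfl
      exact ⟨x, rfl⟩
    exact key a.1 b x a.2 h

/-- Identifies the action recovered from the constructed monad with the original one, so that
`toFibre` is a map of algebras. -/
theorem contractOver_toFibre (T : DTree M.X A.A Z i) :
    contractOver (totalMndProj A) (mapNode (toFibre A) T) = treeVal T := by
  induction T with
  | leaf z => exact app_totalOne A z
  | node b x c ih =>
    rw [mapNode, contractOver]
    simp only [ih]
    -- The root corolla carries the subtrees themselves as leaf decorations; grafting each at its
    -- leaf recovers the whole tree, so `treeVal_bind` applies.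
    let y : (total A).eval (DTree M.X A.A Z) _ := ⟨⟨b, x⟩, c⟩
    have h := treeVal_bind (treeOf y) fun _ T => T
    refine (app_totalMul A _).trans (Eq.trans (congrArg totalJoin ?_) h.symm)
    rw [treeVal_treeOf]
    exact Hom.eq_of_app (totalProj A) rfl (Hom.app_lift (totalProj A) ⟨b, x⟩ _ rfl)

/-- An algebra of `M⁺` maps to the fibres of its polynomial monad. -/
noncomputable def toFibreHom : A ⟶ fibreAlgebra (totalMndProj A) :=
  algebraHomOfAct (toFibre A) fun a U => by
    refine Eq.trans ?_ (algebraAct_fibreAlgebra (totalMndProj A) a _).symm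
    apply Subtype.ext
    refine Eq.trans ?_ (congrArg Sigma.fst (contractOver_toFibre A U.1)).symm
    rw [treeVal_fst, eraseLeaf_self]
    exact (treeOp_eq U).symm

instance : IsIso (toFibreHom A) := by
  have : ∀ a, IsIso ((toFibreHom A).f a) := fun a =>
    (isIso_iff_bijective _).2 (toFibre_bijective A a)
  have : IsIso (toFibreHom A).f := (isIso_pi_iff _).2 this
  exact Monad.algebra_iso_of_iso _ _

end total

/-! ### Essential surjectivity and the equivalence -/

instance (M : PolyMnd I) : (fibreFunctor M).EssSurj where
  mem_essImage A := ⟨Over.mk (totalMndProj A), ⟨(asIso (toFibreHom A)).symm⟩⟩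

end PolyMnd

theorem mainTheorem8 {I : Type u} (M : PolyMnd I) :
    Nonempty ((PolyMnd.toMonad (PolyMnd.baezDolan M)).Algebra ≌ Over M) := by
  have : (PolyMnd.fibreFunctor M).IsEquivalence := {}
  exact ⟨(PolyMnd.fibreFunctor M).asEquivalence.symm⟩
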